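/- Let $\mathbb D=\{z\in\mathbb C: |z|<1\}$. For $a\in[0,1)$ put $\theta_a=2\arcsin a$ and let $\nu_a$ be the probability measure on the arc $\Gamma_a=\{e^{i\theta}:\theta_a\le\theta\le 2\pi-\theta_a\}$ of the unit circle with density $$\frac{d\nu_a}{d\theta}(e^{i\theta})=\frac1{2\pi}\,\frac{\sin(\theta/2)}{\sqrt{\cos^2(\theta_a/2)-\cos^2(\theta/2)}},\qquad \theta_a<\theta<2\pi-\theta_a;$$ let $\nu_1=\delta_{-1}$ be the unit mass at $-1$. (Thus $\nu_a$ is the equilibrium measure of $\Gamma_a$.) For a doubly indexed family $X_{n,N}$ write $\lim_{n/N\to s}X_{n,N}=X$ if $X_{n_j,N_j}\to X$ for all sequences of positive integers $n_j,N_j\to\infty$ with $n_j/N_j\to s$. Let $\{\alpha_{n,N}: n,N\in\mathbb N_0\}\subset\mathbb D$. For each $N$ let the monic polynomials $\Phi_{n,N}$ of degree $n$ be given by $\Phi_{0,N}=1$ and the Szegő recurrence $$\Phi_{n+1,N}(z)=z\,\Phi_{n,N}(z)-\overline{\alpha_{n,N}}\,\Phi_{n,N}^*(z),\qquad \Phi_{n,N}^*(z)=z^n\,\overline{\Phi_{n,N}(1/\bar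 z)},\qquad n\ge 0,$$ and let $\nu_{n,N}=\frac1n\sum_{j=1}^n\delta_{z_{j,n,N}}$, $n\ge1$, where $z_{1,n,N},\dots,z_{n,n,N}$ are the zeros of $\Phi_{n,N}$ counted with multiplicity. **Theorem.** Let $t>0$ and let $\alpha:[0,t]\to\overline{\mathbb D}$ be Lebesgue measurable. Suppose that $$\lim_{n/N\to s}\alpha_{n,N}=\alpha(s)\quad\text{for a.e. } s\in[0,t],\qquad\text{and}\qquad \lim_{n/N\to t}|\alpha_{n-1,N}|^{1/n}=1.$$ Then, in the sense of weak convergence of measures on $\mathbb C$, $$\lim_{n/N\to t}\nu_{n,N}=\frac1t\int_0^t\nu_{|\alpha(s)|}\,ds,$$ that is, for all $n_j,N_j\to\infty$ with $n_j/N_j\to t$ and every bounded continuous $f:\mathbb C\to\mathbb R$, $\int f\,d\nu_{n_j,N_j}\to\int f\,d\sigma_t$, where $\sigma_t(B)=\frac1t\int_0^t\nu_{|\alpha(s)|}(B)\,ds$ for Borel sets $B$. -/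

import Mathlib

open MeasureTheory Filter Topology Polynomial
open scoped ENNReal BoundedContinuousFunction

/-- `lim_{n/N → s} x_{n,N} = l`: convergence along all sequences `n_j, N_j → ∞` with
`n_j / N_j → s`. -/
def RatioTendsto {X : Type*} [TopologicalSpace X] (x : ℕ → ℕ → X) (s : ℝ) (l : X) : Prop :=
  ∀ n N : ℕ → ℕ, Tendsto n atTop atTop → Tendsto N atTop atTop →
    Tendsto (fun j => (n j : ℝ) / (N j : ℝ)) atTop (𝓝 s) →
    Tendsto (fun j => x (n j) (N j)) atTop (𝓝 l)

/-- Weak convergence `μ_{n,N} → ν` as `n/N → s`, tested on bounded continuous functions. -/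
def RatioWeakTendsto (μ : ℕ → ℕ → Measure ℂ) (s : ℝ) (ν : Measure ℂ) : Prop :=
  ∀ f : ℂ →ᵇ ℝ, RatioTendsto (fun n N => ∫ z, f z ∂(μ n N)) s (∫ z, f z ∂ν)

/-- The reversed polynomial `p^*(z) = z^n * conj (p (1 / conj z))` of a polynomial of degree at
most `n`: its coefficient of `z^k` is the conjugate of the coefficient of `z^(n-k)` in `p`. -/
noncomputable def reversedPoly (n : ℕ) (p : ℂ[X]) : ℂ[X] :=
  (p.map (starRingEnd ℂ)).reflect n

/-- The monic orthogonal polynomials on the unit circle with Verblunsky coefficients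
`a 0, a 1, …`, generated by the Szegő recurrence. -/
noncomputable def opuc (a : ℕ → ℂ) : ℕ → ℂ[X]
  | 0 => 1
  | n + 1 => X * opuc a n - C (starRingEnd ℂ (a n)) * reversedPoly n (opuc a n)

/-- The zero-counting measure `(1/n) ∑ δ_{z_j}` of the polynomial `opuc a n`; the sum runs over
its zeros, counted with multiplicity. -/
noncomputable def opucZeroMeasure (a : ℕ → ℂ) (n : ℕ) : Measure ℂ :=
  (n : ℝ≥0∞)⁻¹ • ((opuc a n).roots.map fun z => Measure.dirac z).sum

/-- The endpoint angle `θ_a = 2 arcsin a` of the arc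
`Γ_a = {e^{iθ} : θ_a ≤ θ ≤ 2π - θ_a}`. -/
noncomputable def arcAngle (a : ℝ) : ℝ := 2 * Real.arcsin a

/-- The density in `θ` of the equilibrium measure of `Γ_a`, for `0 ≤ a < 1`. -/
noncomputable def arcDensity (a θ : ℝ) : ℝ :=
  1 / (2 * Real.pi) *
    (Real.sin (θ / 2) / √(Real.cos (arcAngle a / 2) ^ 2 - Real.cos (θ / 2) ^ 2))

/-- The equilibrium measure `ν_a` of the arc `Γ_a`, `0 ≤ a ≤ 1`, as a measure on `ℂ`: absolutely
continuous on the arc if `a ≠ 1`, and the unit mass at `-1` if `a = 1`. -/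
noncomputable def arcMeasure (a : ℝ) : Measure ℂ :=
  if a = 1 then Measure.dirac (-1)
  else ((volume.restrict (Set.Icc (arcAngle a) (2 * Real.pi - arcAngle a))).withDensity
      fun θ => ENNReal.ofReal (arcDensity a θ)).map
    fun θ : ℝ => Complex.exp (θ * Complex.I)

/-- The family `a ↦ ν_a` is measurable, so that it can be averaged with `Measure.bind`. -/
theorem measurable_arcMeasure : Measurable arcMeasure := by
  have hexp : Measurable fun θ : ℝ => Complex.exp (θ * Complex.I) := by fun_prop
  have hang : Measurable arcAngle := by unfold arcAngle; fun_prop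
  have hden : Measurable fun p : ℝ × ℝ => ENNReal.ofReal (arcDensity p.1 p.2) := by
    unfold arcDensity; fun_prop
  refine Measurable.ite (measurableSet_singleton 1) measurable_const ?_
  refine Measure.measurable_of_measurable_coe _ fun s hs => ?_
  have hset : MeasurableSet {p : ℝ × ℝ | p.2 ∈ Set.Icc (arcAngle p.1)
      (2 * Real.pi - arcAngle p.1) ∧ Complex.exp (p.2 * Complex.I) ∈ s} := by
    refine MeasurableSet.inter (MeasurableSet.inter ?_ ?_) ?_
    · exact measurableSet_le (hang.comp measurable_fst) measurable_snd
    · exact measurableSet_le measurable_snd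
        (measurable_const.sub (hang.comp measurable_fst))
    · exact (hexp.comp measurable_snd) hs
  have key := (hden.indicator hset).lintegral_prod_right' (ν := (volume : Measure ℝ))
  convert key using 2 with a
  rw [Measure.map_apply hexp hs, withDensity_apply _ (hexp hs),
    Measure.restrict_restrict (hexp hs), ← lintegral_indicator
      ((hexp hs).inter measurableSet_Icc)]
  refine lintegral_congr fun θ => ?_
  classical
  simp only [Set.indicator]
  exact if_congr and_comm rfl rfl

/-- The average `(1/t) ∫_0^t ν_{|α(s)|} ds`, i.e. the measure
`B ↦ (1/t) ∫_0^t ν_{|α(s)|}(B) ds`. -/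
noncomputable def averagedArcMeasure (α : ℝ → ℂ) (t : ℝ) : Measure ℂ :=
  (ENNReal.ofReal t)⁻¹ • (volume.restrict (Set.Icc 0 t)).bind fun s => arcMeasure ‖α s‖

/-!
The `m`-th power sum of the zeros `zⱼ` of `Φ_n` is the `m`-th coefficient of `-z f_n' / f_n` for
`f_n = z^n Φ_n(1/z) = ∏ (1 - zⱼ z)`, hence a sum over `k < n` of coefficients of the logarithmic
derivatives of `f_{k+1} / f_k`. As `k / N → s` this ratio converges coefficientwise to the solution
`f = 1 + O(z)` of `f² - (1 + z) f + (1 - |α(s)|²) z = 0`, because the Verblunsky coefficients of any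
fixed number of neighbouring indices all tend to `α(s)`. The coefficients of `-z f' / f` are the
moments of `ν_{|α(s)|}`: when the arc is parametrized by `cos (θ/2) = √(1 - |α(s)|²) cos φ`, the
moments differ from them by means of holomorphic functions of `e^{2iφ}` vanishing at `0`.
Dominated convergence turns the mean over `k` into the average over `s`. Since `|α_{n-1}|` is the
modulus of the product of the zeros, the root condition drives the zeros to the unit circle, where
the moments `∫ z^m` with `m ≥ 0` determine the weak limit.
-/

open Finset.HasAntidiagonal (antidiagonal)
open scoped PowerSeries ComplexConjugate

section NegLogDeriv

variable {K : Type*} [Field K]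

/-- The negative logarithmic derivative `-X f' / f` of a power series with nonzero constant
coefficient: for `f = ∏ (1 - zⱼ X)` it is the generating function of the power sums of the `zⱼ`. -/
noncomputable def negLogDeriv (f : K⟦X⟧) : K⟦X⟧ :=
  -(PowerSeries.X * PowerSeries.derivative K f * f⁻¹)

theorem negLogDeriv_mul_self {f : K⟦X⟧} (hf : PowerSeries.constantCoeff f ≠ 0) :
    negLogDeriv f * f = -(PowerSeries.X * PowerSeries.derivative K f) := by
  rw [negLogDeriv, neg_mul, mul_assoc, PowerSeries.inv_mul_cancel _ hf, mul_one]

theorem eq_negLogDeriv {f g : K⟦X⟧} (hf : PowerSeries.constantCoeff f ≠ 0)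
    (h : g * f = -(PowerSeries.X * PowerSeries.derivative K f)) : g = negLogDeriv f := by
  rw [negLogDeriv, ← neg_mul, ← h, mul_assoc, PowerSeries.mul_inv_cancel _ hf, mul_one]

theorem negLogDeriv_mul {f g : K⟦X⟧} (hf : PowerSeries.constantCoeff f ≠ 0)
    (hg : PowerSeries.constantCoeff g ≠ 0) :
    negLogDeriv (f * g) = negLogDeriv f + negLogDeriv g := by
  refine (eq_negLogDeriv (by simp [hf, hg]) ?_).symm
  rw [Derivation.leibniz, smul_eq_mul, smul_eq_mul]
  linear_combination g * negLogDeriv_mul_self hf + f * negLogDeriv_mul_self hg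

@[simp]
theorem negLogDeriv_one : negLogDeriv (1 : K⟦X⟧) = 0 := by
  simp [negLogDeriv]

@[simp]
theorem coeff_zero_negLogDeriv (f : K⟦X⟧) : PowerSeries.coeff 0 (negLogDeriv f) = 0 := by
  simp [negLogDeriv]

theorem coeff_succ_negLogDeriv {f : K⟦X⟧} (hf : PowerSeries.constantCoeff f = 1) (m : ℕ) :
    PowerSeries.coeff (m + 1) (negLogDeriv f) = -((m + 1) * PowerSeries.coeff (m + 1) f) -
      ∑ p ∈ antidiagonal m,
        PowerSeries.coeff p.1 (negLogDeriv f) * PowerSeries.coeff (p.2 + 1) f := by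
  have h := congrArg (PowerSeries.coeff (m + 1)) (negLogDeriv_mul_self (f := f) (by simp [hf]))
  rw [PowerSeries.coeff_mul, Finset.Nat.sum_antidiagonal_succ', map_neg,
    PowerSeries.coeff_succ_X_mul, PowerSeries.coeff_derivative] at h
  simp only [PowerSeries.coeff_zero_eq_constantCoeff, hf] at h
  linear_combination h

theorem negLogDeriv_one_sub_C_mul_X (z : K) :
    negLogDeriv (1 - PowerSeries.C z * PowerSeries.X) =
      PowerSeries.C z * PowerSeries.X * PowerSeries.mk (z ^ ·) := by
  have hgeom : (1 - PowerSeries.C z * PowerSeries.X) * PowerSeries.mk (z ^ ·) = 1 := by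
    ext n
    rw [sub_mul, one_mul, mul_assoc, map_sub, PowerSeries.coeff_C_mul]
    cases n with
    | zero => simp
    | succ n => simp [PowerSeries.coeff_succ_X_mul, PowerSeries.coeff_one, pow_succ']
  refine (eq_negLogDeriv (by simp) ?_).symm
  rw [map_sub, PowerSeries.derivative_one, Derivation.leibniz, smul_eq_mul, smul_eq_mul,
    PowerSeries.derivative_X, PowerSeries.derivative_C]
  linear_combination PowerSeries.C z * PowerSeries.X * hgeom

theorem coeff_negLogDeriv_one_sub_C_mul_X (z : K) {m : ℕ} (hm : m ≠ 0) :
    PowerSeries.coeff m (negLogDeriv (1 - PowerSeries.C z * PowerSeries.X)) = z ^ m := by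
  obtain ⟨m, rfl⟩ := Nat.exists_eq_succ_of_ne_zero hm
  rw [negLogDeriv_one_sub_C_mul_X, mul_assoc, PowerSeries.coeff_C_mul,
    PowerSeries.coeff_succ_X_mul, PowerSeries.coeff_mk, pow_succ']

theorem coeff_negLogDeriv_prod_one_sub_C_mul_X (s : Multiset K) {m : ℕ} (hm : m ≠ 0) :
    PowerSeries.coeff m
      (negLogDeriv (s.map fun z => 1 - PowerSeries.C z * PowerSeries.X).prod) =
      (s.map (· ^ m)).sum := by
  induction s using Multiset.induction_on with
  | empty => simp
  | cons z s ih =>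
    rw [Multiset.map_cons, Multiset.prod_cons, negLogDeriv_mul (by simp)
      (by simp [map_multiset_prod, Multiset.map_map]), map_add, ih,
      coeff_negLogDeriv_one_sub_C_mul_X z hm, Multiset.map_cons, Multiset.sum_cons]

variable (K) in
theorem exists_mvPolynomial_coeff_negLogDeriv (m : ℕ) :
    ∃ P : MvPolynomial ℕ K, ∀ f : K⟦X⟧, PowerSeries.constantCoeff f = 1 →
      PowerSeries.coeff m (negLogDeriv f) = P.eval fun k => PowerSeries.coeff k f := by
  induction m using Nat.strong_induction_on with
  | _ m ih =>
    choose! P hP using ih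
    cases m with
    | zero => exact ⟨0, fun f _ => by simp⟩
    | succ m =>
      refine ⟨-(MvPolynomial.C (m + 1 : K) * MvPolynomial.X (m + 1)) -
        ∑ p ∈ antidiagonal m, P p.1 * MvPolynomial.X (p.2 + 1), fun f hf => ?_⟩
      have hsum : ∑ p ∈ antidiagonal m,
          PowerSeries.coeff p.1 (negLogDeriv f) * PowerSeries.coeff (p.2 + 1) f =
          ∑ p ∈ antidiagonal m,
            (P p.1).eval (fun k => PowerSeries.coeff k f) * PowerSeries.coeff (p.2 + 1) f :=
        Finset.sum_congr rfl fun p hp => by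
          rw [hP p.1 (Finset.Nat.antidiagonal.fst_lt hp) f hf]
      rw [coeff_succ_negLogDeriv hf, hsum]
      simp

theorem tendsto_coeff_negLogDeriv [TopologicalSpace K]
    [IsTopologicalSemiring K] {ι : Type*} {l : Filter ι} {f : ι → K⟦X⟧} {g : K⟦X⟧}
    (hf : ∀ i, PowerSeries.constantCoeff (f i) = 1) (hg : PowerSeries.constantCoeff g = 1)
    (h : ∀ k, Tendsto (fun i => PowerSeries.coeff k (f i)) l (𝓝 (PowerSeries.coeff k g)))
    (m : ℕ) :
    Tendsto (fun i => PowerSeries.coeff m (negLogDeriv (f i))) l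
      (𝓝 (PowerSeries.coeff m (negLogDeriv g))) := by
  obtain ⟨P, hP⟩ := exists_mvPolynomial_coeff_negLogDeriv K m
  simp only [hP _ (hf _), hP _ hg]
  exact (P.continuous_eval.tendsto _).comp (tendsto_pi_nhds.2 h)

theorem exists_bound_coeff_negLogDeriv {K : Type*} [NormedField K] [ProperSpace K]
    {ι : Type*} {f : ι → K⟦X⟧} (hf : ∀ i, PowerSeries.constantCoeff (f i) = 1)
    (h : ∀ k, ∃ B : ℝ, ∀ i, ‖PowerSeries.coeff k (f i)‖ ≤ B) (m : ℕ) :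
    ∃ B : ℝ, ∀ i, ‖PowerSeries.coeff m (negLogDeriv (f i))‖ ≤ B := by
  obtain ⟨P, hP⟩ := exists_mvPolynomial_coeff_negLogDeriv K m
  choose B hB using h
  obtain ⟨D, hD⟩ := (isCompact_univ_pi fun k => isCompact_closedBall (0 : K) (B k))
    |>.exists_bound_of_continuousOn P.continuous_eval.continuousOn
  refine ⟨D, fun i => ?_⟩
  rw [hP _ (hf i)]
  exact hD _ fun k _ => mem_closedBall_zero_iff.2 (hB k i)

theorem differentiable_coeff_negLogDeriv {f : ℂ → ℂ⟦X⟧}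
    (hf : ∀ u, PowerSeries.constantCoeff (f u) = 1)
    (h : ∀ k, Differentiable ℂ fun u => PowerSeries.coeff k (f u)) (m : ℕ) :
    Differentiable ℂ fun u => PowerSeries.coeff m (negLogDeriv (f u)) := by
  obtain ⟨P, hP⟩ := exists_mvPolynomial_coeff_negLogDeriv ℂ m
  simp only [hP _ (hf _), ← MvPolynomial.coe_aeval_eq_eval]
  exact fun u => (AnalyticAt.aeval_mvPolynomial (fun k => (h k).analyticAt u) P).differentiableAt

end NegLogDeriv

section RatioAtTop

/-- The filter of the pairs `(n, N)` with `n, N → ∞` and `n / N → s`, along which `RatioTendsto`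
is ordinary convergence. -/
noncomputable def ratioAtTop (s : ℝ) : Filter (ℕ × ℕ) :=
  (atTop ×ˢ atTop) ⊓ comap (fun p => (p.1 : ℝ) / p.2) (𝓝 s)

instance (s : ℝ) : (ratioAtTop s).IsCountablyGenerated := by
  unfold ratioAtTop; infer_instance

theorem tendsto_ratioAtTop_iff {ι : Type*} {l : Filter ι} {p : ι → ℕ × ℕ} {s : ℝ} :
    Tendsto p l (ratioAtTop s) ↔ (Tendsto (fun i => (p i).1) l atTop ∧
      Tendsto (fun i => (p i).2) l atTop) ∧
      Tendsto (fun i => ((p i).1 : ℝ) / (p i).2) l (𝓝 s) := by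
  rw [ratioAtTop, tendsto_inf, tendsto_comap_iff, tendsto_prod_iff']
  rfl

theorem ratioTendsto_iff {X : Type*} [TopologicalSpace X] {x : ℕ → ℕ → X} {s : ℝ} {l : X} :
    RatioTendsto x s l ↔ Tendsto (fun p : ℕ × ℕ => x p.1 p.2) (ratioAtTop s) (𝓝 l) := by
  rw [tendsto_iff_seq_tendsto]
  refine ⟨fun h p hp => ?_, fun h n N hn hN hs => ?_⟩
  · obtain ⟨⟨hn, hN⟩, hs⟩ := tendsto_ratioAtTop_iff.1 hp
    exact h _ _ hn hN hs
  · exact h (fun j => (n j, N j)) (tendsto_ratioAtTop_iff.2 ⟨⟨hn, hN⟩, hs⟩)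

theorem tendsto_fst_ratioAtTop (s : ℝ) : Tendsto Prod.fst (ratioAtTop s) atTop :=
  (tendsto_ratioAtTop_iff.1 tendsto_id).1.1

theorem tendsto_snd_ratioAtTop (s : ℝ) : Tendsto Prod.snd (ratioAtTop s) atTop :=
  (tendsto_ratioAtTop_iff.1 tendsto_id).1.2

theorem tendsto_div_ratioAtTop (s : ℝ) :
    Tendsto (fun p : ℕ × ℕ => (p.1 : ℝ) / p.2) (ratioAtTop s) (𝓝 s) :=
  (tendsto_ratioAtTop_iff.1 tendsto_id).2

theorem tendsto_inv_snd_ratioAtTop (s : ℝ) :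
    Tendsto (fun p : ℕ × ℕ => (p.2 : ℝ)⁻¹) (ratioAtTop s) (𝓝 0) :=
  tendsto_inv_atTop_nhds_zero_nat.comp (tendsto_snd_ratioAtTop s)

theorem tendsto_succ_ratioAtTop (s : ℝ) :
    Tendsto (fun p : ℕ × ℕ => (p.1 + 1, p.2)) (ratioAtTop s) (ratioAtTop s) := by
  refine tendsto_ratioAtTop_iff.2 ⟨⟨(tendsto_add_atTop_nat 1).comp (tendsto_fst_ratioAtTop s),
    tendsto_snd_ratioAtTop s⟩, ?_⟩
  simpa [add_div] using (tendsto_div_ratioAtTop s).add (tendsto_inv_snd_ratioAtTop s)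

theorem tendsto_pred_ratioAtTop (s : ℝ) :
    Tendsto (fun p : ℕ × ℕ => (p.1 - 1, p.2)) (ratioAtTop s) (ratioAtTop s) := by
  refine tendsto_ratioAtTop_iff.2 ⟨⟨(tendsto_sub_atTop_nat 1).comp (tendsto_fst_ratioAtTop s),
    tendsto_snd_ratioAtTop s⟩, ?_⟩
  have h := (tendsto_div_ratioAtTop s).sub (tendsto_inv_snd_ratioAtTop s)
  rw [sub_zero] at h
  refine h.congr' ?_
  filter_upwards [(tendsto_fst_ratioAtTop s).eventually_ge_atTop 1] with p hp
  rw [Nat.cast_sub hp, Nat.cast_one, sub_div, one_div]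

theorem tendsto_ratioAtTop_of_succ {X : Type*} {l : Filter X} {x : ℕ × ℕ → X} {s : ℝ}
    (h : Tendsto (fun p : ℕ × ℕ => x (p.1 + 1, p.2)) (ratioAtTop s) l) :
    Tendsto x (ratioAtTop s) l := by
  refine (h.comp (tendsto_pred_ratioAtTop s)).congr' ?_
  filter_upwards [(tendsto_fst_ratioAtTop s).eventually_ge_atTop 1] with p hp
  simp only [Function.comp_apply, Nat.sub_add_cancel hp]

theorem tendsto_floor_mul_ratioAtTop {s u : ℝ} (hu : 0 < u) :
    Tendsto (fun p : ℕ × ℕ => (⌊p.1 * u⌋₊, p.2)) (ratioAtTop s) (ratioAtTop (s * u)) := by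
  have hn : Tendsto (fun p : ℕ × ℕ => (p.1 : ℝ)) (ratioAtTop s) atTop :=
    tendsto_natCast_atTop_atTop.comp (tendsto_fst_ratioAtTop s)
  refine tendsto_ratioAtTop_iff.2 ⟨⟨tendsto_nat_floor_atTop.comp (hn.atTop_mul_const hu),
    tendsto_snd_ratioAtTop s⟩, ?_⟩
  have h := ((tendsto_nat_floor_mul_div_atTop hu.le).comp hn).mul (tendsto_div_ratioAtTop s)
  rw [mul_comm u s] at h
  refine h.congr' ?_
  filter_upwards [(tendsto_fst_ratioAtTop s).eventually_ge_atTop 1] with p hp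
  have hp' : (p.1 : ℝ) ≠ 0 := by positivity
  simp only [Function.comp_apply, mul_comm u]
  field_simp

theorem tendsto_floor_mul_id_ratioAtTop {s : ℝ} (hs : 0 < s) :
    Tendsto (fun j : ℕ => (⌊j * s⌋₊, j)) atTop (ratioAtTop s) := by
  have hdiag : Tendsto (fun j : ℕ => (j, j)) atTop (ratioAtTop 1) := by
    refine tendsto_ratioAtTop_iff.2 ⟨⟨tendsto_id, tendsto_id⟩, tendsto_const_nhds.congr' ?_⟩
    filter_upwards [eventually_ge_atTop 1] with j hj
    have hj' : (j : ℝ) ≠ 0 := by positivity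
    simp [hj']
  have h := (tendsto_floor_mul_ratioAtTop hs).comp hdiag
  rwa [one_mul] at h

end RatioAtTop

section Opuc

theorem natDegree_reversedPoly_le {n : ℕ} {p : ℂ[X]} (hp : p.natDegree ≤ n) :
    (reversedPoly n p).natDegree ≤ n :=
  natDegree_reflect_le.trans (max_le le_rfl (natDegree_map_le.trans hp))

theorem reflect_reversedPoly (n : ℕ) (p : ℂ[X]) :
    (reversedPoly n p).reflect n = p.map (starRingEnd ℂ) := by
  rw [reversedPoly, reflect_reflect]

theorem map_conj_reversedPoly (n : ℕ) (p : ℂ[X]) :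
    (reversedPoly n p).map (starRingEnd ℂ) = p.reflect n := by
  rw [reversedPoly, ← reflect_map, Polynomial.map_map, RingHomInvPair.comp_eq, Polynomial.map_id]

theorem reflect_succ {R : Type*} [Semiring R] {n : ℕ} {p : R[X]} (hp : p.natDegree ≤ n) :
    p.reflect (n + 1) = X * p.reflect n := by
  have := reflect_mul (1 : R[X]) p (F := 1) (G := n) (by simp) hp
  rwa [one_mul, add_comm, reflect_one, pow_one] at this

theorem reflect_succ_X_mul {R : Type*} [Semiring R] {n : ℕ} {p : R[X]} (hp : p.natDegree ≤ n) :
    (X * p).reflect (n + 1) = p.reflect n := by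
  have := reflect_mul (X : R[X]) p (F := 1) (G := n) (natDegree_X_le) hp
  rwa [add_comm, reflect_one_X, one_mul] at this

theorem monic_and_natDegree_opuc (a : ℕ → ℂ) (n : ℕ) :
    (opuc a n).Monic ∧ (opuc a n).natDegree = n := by
  induction n with
  | zero => simp [opuc]
  | succ n ih =>
    obtain ⟨hm, hd⟩ := ih
    have hX : (X * opuc a n).Monic := monic_X.mul hm
    have hXd : (X * opuc a n).natDegree = n + 1 := by rw [natDegree_X_mul hm.ne_zero, hd]
    have hlt : (C (conj (a n)) * reversedPoly n (opuc a n)).degree < (X * opuc a n).degree := by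
      refine degree_lt_degree ?_
      rw [hXd]
      exact Nat.lt_succ_of_le
        ((natDegree_C_mul_le _ _).trans (natDegree_reversedPoly_le hd.le))
    refine ⟨hX.sub_of_left hlt, ?_⟩
    rw [opuc, natDegree_eq_of_degree_eq (degree_sub_eq_left_of_degree_lt hlt), hXd]

theorem monic_opuc (a : ℕ → ℂ) (n : ℕ) : (opuc a n).Monic :=
  (monic_and_natDegree_opuc a n).1

theorem natDegree_opuc (a : ℕ → ℂ) (n : ℕ) : (opuc a n).natDegree = n :=
  (monic_and_natDegree_opuc a n).2

theorem coeff_self_opuc (a : ℕ → ℂ) (n : ℕ) : (opuc a n).coeff n = 1 := by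
  simpa only [natDegree_opuc] using (monic_opuc a n).coeff_natDegree

theorem card_roots_opuc (a : ℕ → ℂ) (n : ℕ) : (opuc a n).roots.card = n := by
  rw [IsAlgClosed.card_roots_eq_natDegree, natDegree_opuc]

theorem reversedPoly_opuc_succ (a : ℕ → ℂ) (n : ℕ) :
    reversedPoly (n + 1) (opuc a (n + 1)) =
      reversedPoly n (opuc a n) - C (a n) * (X * opuc a n) := by
  have hd : ((opuc a n).map (starRingEnd ℂ)).natDegree ≤ n :=
    natDegree_map_le.trans (natDegree_opuc a n).le
  have hr : ((opuc a n).reflect n).natDegree ≤ n :=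
    natDegree_reflect_le.trans (by simp [natDegree_opuc])
  conv_lhs => rw [opuc, reversedPoly]
  rw [Polynomial.map_sub, Polynomial.map_mul, Polynomial.map_mul, map_X, map_C, reflect_sub,
    reflect_succ_X_mul hd, map_conj_reversedPoly, reflect_C_mul, reflect_succ hr,
    reflect_reflect, Complex.conj_conj, reversedPoly]

theorem norm_sub_conj_mul_sq_sub_norm_sub_mul_sq (α w v : ℂ) :
    ‖w - conj α * v‖ ^ 2 - ‖v - α * w‖ ^ 2 = (1 - ‖α‖ ^ 2) * (‖w‖ ^ 2 - ‖v‖ ^ 2) := by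
  simp only [← Complex.normSq_eq_norm_sq, Complex.normSq_apply, Complex.sub_re, Complex.sub_im,
    Complex.mul_re, Complex.mul_im, Complex.conj_re, Complex.conj_im]
  ring

theorem eval_opuc_ne_zero_and_norm_eval_reversedPoly_le {a : ℕ → ℂ} (ha : ∀ n, ‖a n‖ ≤ 1) {z : ℂ}
    (hz : 1 < ‖z‖) (n : ℕ) :
    (opuc a n).eval z ≠ 0 ∧ ‖(reversedPoly n (opuc a n)).eval z‖ ≤ ‖(opuc a n).eval z‖ := by
  induction n with
  | zero => simp [opuc, reversedPoly]
  | succ n ih =>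
    obtain ⟨h0, hle⟩ := ih
    rw [reversedPoly_opuc_succ, opuc]
    simp only [eval_sub, eval_mul, eval_X, eval_C]
    set p := (opuc a n).eval z
    set q := (reversedPoly n (opuc a n)).eval z
    have hlt : ‖q‖ < ‖z * p‖ := by
      rw [norm_mul]
      exact hle.trans_lt (lt_mul_of_one_lt_left (norm_pos_iff.2 h0) hz)
    constructor
    · refine sub_ne_zero.2 fun h => hlt.not_ge ?_
      rw [h, norm_mul, RCLike.norm_conj]
      exact mul_le_of_le_one_left (norm_nonneg q) (ha n)
    · have hsq := norm_sub_conj_mul_sq_sub_norm_sub_mul_sq (a n) (z * p) q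
      have ha2 : ‖a n‖ ^ 2 ≤ 1 := pow_le_one₀ (norm_nonneg _) (ha n)
      have hlt2 : ‖q‖ ^ 2 ≤ ‖z * p‖ ^ 2 := by gcongr
      refine (sq_le_sq₀ (norm_nonneg _) (norm_nonneg _)).1 ?_
      linarith [mul_nonneg (sub_nonneg.2 ha2) (sub_nonneg.2 hlt2)]

theorem norm_le_one_of_mem_roots_opuc {a : ℕ → ℂ} (ha : ∀ n, ‖a n‖ ≤ 1) {n : ℕ} {z : ℂ}
    (hz : z ∈ (opuc a n).roots) : ‖z‖ ≤ 1 := by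
  by_contra! h
  exact (eval_opuc_ne_zero_and_norm_eval_reversedPoly_le ha h n).1 (isRoot_of_mem_roots hz)

theorem coeff_zero_opuc_succ (a : ℕ → ℂ) (n : ℕ) :
    (opuc a (n + 1)).coeff 0 = -conj (a n) := by
  have hc : (reversedPoly n (opuc a n)).coeff 0 = 1 := by
    rw [reversedPoly, coeff_reflect, revAt_zero, coeff_map, coeff_self_opuc, map_one]
  rw [opuc, coeff_sub, coeff_C_mul, hc, mul_coeff_zero, coeff_X_zero]
  ring

theorem prod_norm_roots_opuc_succ (a : ℕ → ℂ) (n : ℕ) :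
    ((opuc a (n + 1)).roots.map norm).prod = ‖a n‖ := by
  have hprod := (IsAlgClosed.splits (opuc a (n + 1))).coeff_zero_eq_prod_roots_of_monic
    (monic_opuc a (n + 1))
  have hnorm := congrArg norm hprod
  rw [coeff_zero_opuc_succ, norm_neg, RCLike.norm_conj, norm_mul, norm_pow, norm_neg, norm_one,
    one_pow, one_mul] at hnorm
  rw [hnorm]
  exact ((normHom : ℂ →*₀ ℝ).toMonoidHom.map_multiset_prod _).symm

/-- The polynomial `z^n Φ_n(1/z) = ∏ (1 - zⱼ z)`, `zⱼ` the zeros of `Φ_n`, as a power series. -/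
noncomputable def opucReverse (a : ℕ → ℂ) (n : ℕ) : ℂ⟦X⟧ :=
  ((opuc a n).reflect n : ℂ[X])

/-- The quotient `Φ_n^* / Φ_n` expanded at infinity, as a power series in `1/z`. -/
noncomputable def opucQuot (a : ℕ → ℂ) (n : ℕ) : ℂ⟦X⟧ :=
  ((opuc a n).map (starRingEnd ℂ) : ℂ[X]) * (opucReverse a n)⁻¹

/-- The ratio `Φ_{n+1}(z) / (z Φ_n(z))` expanded at infinity, as a power series in `1/z`. -/
noncomputable def opucRatio (a : ℕ → ℂ) (n : ℕ) : ℂ⟦X⟧ :=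
  1 - PowerSeries.C (conj (a n)) * (PowerSeries.X * opucQuot a n)

@[simp]
theorem constantCoeff_opucReverse (a : ℕ → ℂ) (n : ℕ) :
    PowerSeries.constantCoeff (opucReverse a n) = 1 := by
  rw [opucReverse, ← PowerSeries.coeff_zero_eq_constantCoeff_apply, Polynomial.coeff_coe,
    coeff_reflect, revAt_zero, coeff_self_opuc]

@[simp]
theorem constantCoeff_opucRatio (a : ℕ → ℂ) (n : ℕ) :
    PowerSeries.constantCoeff (opucRatio a n) = 1 := by
  simp [opucRatio]

theorem opucQuot_mul_opucReverse (a : ℕ → ℂ) (n : ℕ) :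
    opucQuot a n * opucReverse a n = ((opuc a n).map (starRingEnd ℂ) : ℂ[X]) := by
  rw [opucQuot, mul_assoc, PowerSeries.inv_mul_cancel _ (by simp), mul_one]

theorem opucReverse_succ (a : ℕ → ℂ) (n : ℕ) :
    opucReverse a (n + 1) = opucReverse a n * opucRatio a n := by
  have hd := natDegree_opuc a n
  rw [opucReverse, opuc, reflect_sub, reflect_succ_X_mul hd.le, reflect_C_mul,
    reflect_succ (natDegree_reversedPoly_le hd.le), reflect_reversedPoly, opucRatio]
  push_cast
  rw [← opucQuot_mul_opucReverse, ← opucReverse]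
  ring

theorem opucQuot_succ_mul_opucRatio (a : ℕ → ℂ) (n : ℕ) :
    opucQuot a (n + 1) * opucRatio a n =
      PowerSeries.X * opucQuot a n - PowerSeries.C (a n) := by
  have h := opucQuot_mul_opucReverse a (n + 1)
  rw [opucReverse_succ, opuc, Polynomial.map_sub, Polynomial.map_mul, Polynomial.map_mul, map_X,
    map_C, map_conj_reversedPoly, Complex.conj_conj] at h
  push_cast at h
  rw [← opucQuot_mul_opucReverse, ← opucReverse] at h
  have hne : opucReverse a n ≠ 0 := fun h0 => by
    simpa [h0] using constantCoeff_opucReverse a n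
  refine mul_right_cancel₀ hne ?_
  linear_combination h

theorem opucQuot_zero (a : ℕ → ℂ) : opucQuot a 0 = 1 := by
  simpa [opucReverse, opuc] using opucQuot_mul_opucReverse a 0

theorem coeff_zero_opucQuot_succ (a : ℕ → ℂ) (n : ℕ) :
    PowerSeries.coeff 0 (opucQuot a (n + 1)) = -a n := by
  simpa using congrArg PowerSeries.constantCoeff (opucQuot_succ_mul_opucRatio a n)

theorem coeff_succ_opucQuot_succ (a : ℕ → ℂ) (n m : ℕ) :
    PowerSeries.coeff (m + 1) (opucQuot a (n + 1)) =
      PowerSeries.coeff m (opucQuot a n) + conj (a n) *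
        ∑ p ∈ antidiagonal m, PowerSeries.coeff p.1 (opucQuot a n) *
          PowerSeries.coeff p.2 (opucQuot a (n + 1)) := by
  have h : opucQuot a (n + 1) = PowerSeries.X * opucQuot a n - PowerSeries.C (a n) +
      PowerSeries.C (conj (a n)) *
        (PowerSeries.X * (opucQuot a n * opucQuot a (n + 1))) := by
    rw [← opucQuot_succ_mul_opucRatio, opucRatio]
    ring
  have hcoeff := congrArg (PowerSeries.coeff (m + 1)) h
  rw [map_add, map_sub, PowerSeries.coeff_C_mul, PowerSeries.coeff_succ_X_mul,
    PowerSeries.coeff_succ_X_mul, PowerSeries.coeff_mul] at hcoeff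
  simpa [PowerSeries.coeff_C] using hcoeff

theorem coeff_succ_opucRatio (a : ℕ → ℂ) (n m : ℕ) :
    PowerSeries.coeff (m + 1) (opucRatio a n) =
      -(conj (a n) * PowerSeries.coeff m (opucQuot a n)) := by
  rw [opucRatio, map_sub, PowerSeries.coeff_C_mul, PowerSeries.coeff_succ_X_mul]
  simp [PowerSeries.coeff_one]

theorem reverse_prod_X_sub_C {R : Type*} [CommRing R] [IsDomain R] (s : Multiset R) :
    (s.map fun z => X - C z).prod.reverse = (s.map fun z => 1 - C z * X).prod := by
  induction s using Multiset.induction_on with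
  | empty => simp [reverse]
  | cons z s ih =>
    have hz : (X - C z : R[X]).reverse = 1 - C z * X := by
      rw [reverse, natDegree_X_sub_C, reflect_sub, reflect_one_X, reflect_C, pow_one]
    rw [Multiset.map_cons, Multiset.prod_cons, reverse_mul_of_domain, ih, hz, Multiset.map_cons,
      Multiset.prod_cons]

theorem opucReverse_eq_prod_roots (a : ℕ → ℂ) (n : ℕ) :
    opucReverse a n =
      ((opuc a n).roots.map fun z => 1 - PowerSeries.C z * PowerSeries.X).prod := by
  have hprod := (IsAlgClosed.splits (opuc a n)).eq_prod_roots_of_monic (monic_opuc a n)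
  have hrev : (opuc a n).reflect n = ((opuc a n).roots.map fun z => 1 - C z * X).prod := by
    rw [← reverse_prod_X_sub_C, ← hprod, reverse, natDegree_opuc]
  rw [opucReverse, hrev, ← coeToPowerSeries.ringHom_apply, map_multiset_prod, Multiset.map_map]
  simp [Function.comp_def]

theorem sum_roots_opuc_pow (a : ℕ → ℂ) (n : ℕ) {m : ℕ} (hm : m ≠ 0) :
    ((opuc a n).roots.map (· ^ m)).sum =
      ∑ k ∈ Finset.range n, PowerSeries.coeff m (negLogDeriv (opucRatio a k)) := by
  rw [← coeff_negLogDeriv_prod_one_sub_C_mul_X _ hm, ← opucReverse_eq_prod_roots]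
  induction n with
  | zero => simp [opucReverse, opuc]
  | succ n ih =>
    rw [Finset.sum_range_succ, ← ih, opucReverse_succ, negLogDeriv_mul (by simp) (by simp),
      map_add]

theorem exists_bound_coeff_opucQuot (m : ℕ) :
    ∃ B : ℝ, ∀ a : ℕ → ℂ, (∀ n, ‖a n‖ ≤ 1) → ∀ n,
      ‖PowerSeries.coeff m (opucQuot a n)‖ ≤ B := by
  induction m using Nat.strong_induction_on with
  | _ m ih =>
    choose! B hB using ih
    have hzero (a : ℕ → ℂ) : ‖PowerSeries.coeff m (opucQuot a 0)‖ ≤ 1 := by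
      rw [opucQuot_zero, PowerSeries.coeff_one]
      split_ifs <;> simp
    cases m with
    | zero =>
      refine ⟨1, fun a ha n => ?_⟩
      cases n with
      | zero => exact hzero a
      | succ n => rw [coeff_zero_opucQuot_succ, norm_neg]; exact ha n
    | succ m =>
      refine ⟨max 1 (B m + ∑ p ∈ antidiagonal m, B p.1 * B p.2), fun a ha n => ?_⟩
      cases n with
      | zero => exact le_max_of_le_left (hzero a)
      | succ n =>
        refine le_max_of_le_right ?_
        rw [coeff_succ_opucQuot_succ]
        refine norm_add_le_of_le (hB m m.lt_succ_self a ha n) ?_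
        rw [norm_mul, RCLike.norm_conj]
        refine (mul_le_of_le_one_left (norm_nonneg _) (ha n)).trans
          (norm_sum_le_of_le _ fun p hp => ?_)
        exact norm_mul_le_of_le (hB _ (Finset.Nat.antidiagonal.fst_lt hp) a ha n)
          (hB _ (Finset.Nat.antidiagonal.snd_lt hp) a ha (n + 1))

theorem exists_bound_coeff_negLogDeriv_opucRatio (m : ℕ) :
    ∃ B : ℝ, ∀ a : ℕ → ℂ, (∀ n, ‖a n‖ ≤ 1) → ∀ n,
      ‖PowerSeries.coeff m (negLogDeriv (opucRatio a n))‖ ≤ B := by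
  have hratio (k : ℕ) : ∃ B : ℝ, ∀ p : {a : ℕ → ℂ // ∀ n, ‖a n‖ ≤ 1} × ℕ,
      ‖PowerSeries.coeff k (opucRatio p.1 p.2)‖ ≤ B := by
    cases k with
    | zero => exact ⟨1, fun p => by simp⟩
    | succ k =>
      obtain ⟨B, hB⟩ := exists_bound_coeff_opucQuot k
      refine ⟨B, fun ⟨⟨a, ha⟩, n⟩ => ?_⟩
      rw [coeff_succ_opucRatio, norm_neg, norm_mul, RCLike.norm_conj]
      exact (mul_le_of_le_one_left (norm_nonneg _) (ha n)).trans (hB a ha n)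
  obtain ⟨B, hB⟩ := exists_bound_coeff_negLogDeriv (fun p => constantCoeff_opucRatio _ _) hratio m
  exact ⟨B, fun a ha n => hB (⟨a, ha⟩, n)⟩

end Opuc

section LimitRatio

/-- The coefficients of the solution `b` of `b = X b - α + conj α X b ^ 2`, the limit of
`opucQuot` when the Verblunsky coefficients tend to `α`. -/
noncomputable def limitQuotCoeff (α : ℂ) : ℕ → ℂ
  | 0 => -α
  | m + 1 => limitQuotCoeff α m + conj α *
      ∑ i : Fin (m + 1), limitQuotCoeff α i * limitQuotCoeff α (m - i)

theorem limitQuotCoeff_succ (α : ℂ) (m : ℕ) :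
    limitQuotCoeff α (m + 1) = limitQuotCoeff α m + conj α *
      ∑ p ∈ antidiagonal m, limitQuotCoeff α p.1 * limitQuotCoeff α p.2 := by
  rw [limitQuotCoeff, Finset.Nat.sum_antidiagonal_eq_sum_range_succ
    (fun i j => limitQuotCoeff α i * limitQuotCoeff α j), Finset.sum_range]

/-- The limit of `opucRatio` when the Verblunsky coefficients tend to `α`. -/
noncomputable def limitRatio (α : ℂ) : ℂ⟦X⟧ :=
  1 - PowerSeries.C (conj α) * (PowerSeries.X * PowerSeries.mk (limitQuotCoeff α))

@[simp]
theorem constantCoeff_limitRatio (α : ℂ) : PowerSeries.constantCoeff (limitRatio α) = 1 := by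
  simp [limitRatio]

theorem coeff_succ_limitRatio (α : ℂ) (m : ℕ) :
    PowerSeries.coeff (m + 1) (limitRatio α) = -(conj α * limitQuotCoeff α m) := by
  rw [limitRatio, map_sub, PowerSeries.coeff_C_mul, PowerSeries.coeff_succ_X_mul]
  simp [PowerSeries.coeff_one]

theorem mk_limitQuotCoeff (α : ℂ) :
    PowerSeries.mk (limitQuotCoeff α) =
      PowerSeries.X * PowerSeries.mk (limitQuotCoeff α) - PowerSeries.C α +
        PowerSeries.C (conj α) * (PowerSeries.X *
          (PowerSeries.mk (limitQuotCoeff α) * PowerSeries.mk (limitQuotCoeff α))) := by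
  ext m
  rw [map_add, map_sub, PowerSeries.coeff_C_mul]
  cases m with
  | zero => simp [limitQuotCoeff]
  | succ m =>
    rw [PowerSeries.coeff_succ_X_mul, PowerSeries.coeff_succ_X_mul, PowerSeries.coeff_mul]
    simp [limitQuotCoeff_succ]

theorem limitRatio_mul_sub (α : ℂ) :
    limitRatio α * (limitRatio α - (1 + PowerSeries.X)) =
      -(PowerSeries.C (1 - (‖α‖ : ℂ) ^ 2) * PowerSeries.X) := by
  have hC : PowerSeries.C (1 - (‖α‖ : ℂ) ^ 2) =
      1 - PowerSeries.C (conj α) * PowerSeries.C α := by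
    rw [← map_mul, ← map_one (PowerSeries.C (R := ℂ)), ← map_sub, Complex.conj_mul']
  rw [hC, limitRatio]
  linear_combination -(PowerSeries.C (conj α) * PowerSeries.X) * mk_limitQuotCoeff α

variable {a : ℕ → ℕ → ℂ} {s : ℝ} {α : ℂ}

theorem RatioTendsto.coeff_opucQuot (h : RatioTendsto a s α) (m : ℕ) :
    Tendsto (fun p : ℕ × ℕ => PowerSeries.coeff m (opucQuot (a · p.2) p.1)) (ratioAtTop s)
      (𝓝 (limitQuotCoeff α m)) := by
  have ha := ratioTendsto_iff.1 h
  induction m using Nat.strong_induction_on with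
  | _ m ih =>
    refine tendsto_ratioAtTop_of_succ ?_
    cases m with
    | zero =>
      simp only [coeff_zero_opucQuot_succ]
      rw [limitQuotCoeff]
      exact ha.neg
    | succ m =>
      simp only [coeff_succ_opucQuot_succ]
      rw [limitQuotCoeff_succ]
      refine (ih m m.lt_succ_self).add
        (((Complex.continuous_conj.tendsto _).comp ha).mul (tendsto_finsetSum _ fun p hp => ?_))
      have hsnd := (ih p.2 (Finset.Nat.antidiagonal.snd_lt hp)).comp (tendsto_succ_ratioAtTop s)
      exact (ih p.1 (Finset.Nat.antidiagonal.fst_lt hp)).mul hsnd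

theorem RatioTendsto.coeff_opucRatio (h : RatioTendsto a s α) (m : ℕ) :
    Tendsto (fun p : ℕ × ℕ => PowerSeries.coeff m (opucRatio (a · p.2) p.1)) (ratioAtTop s)
      (𝓝 (PowerSeries.coeff m (limitRatio α))) := by
  cases m with
  | zero => simp [tendsto_const_nhds]
  | succ m =>
    simp only [coeff_succ_opucRatio, coeff_succ_limitRatio]
    exact (((Complex.continuous_conj.tendsto _).comp (ratioTendsto_iff.1 h)).mul
      (h.coeff_opucQuot m)).neg

theorem RatioTendsto.coeff_negLogDeriv_opucRatio (h : RatioTendsto a s α) (m : ℕ) :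
    Tendsto (fun p : ℕ × ℕ => PowerSeries.coeff m (negLogDeriv (opucRatio (a · p.2) p.1)))
      (ratioAtTop s) (𝓝 (PowerSeries.coeff m (negLogDeriv (limitRatio α)))) :=
  tendsto_coeff_negLogDeriv (fun _ => constantCoeff_opucRatio _ _) (constantCoeff_limitRatio α)
    h.coeff_opucRatio m

end LimitRatio

section Average

variable {E : Type*} [NormedAddCommGroup E] [NormedSpace ℝ E]

theorem integral_comp_floor [CompleteSpace E] (x : ℕ → E) (n : ℕ) :
    ∫ v in (0 : ℝ)..n, x ⌊v⌋₊ = ∑ k ∈ Finset.range n, x k := by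
  have hle (k : ℕ) : (k : ℝ) ≤ (k + 1 : ℕ) := by simp
  have hfloor (k : ℕ) : (Set.Ioo (k : ℝ) (k + 1 : ℕ)).EqOn (fun _ => x k) (fun v => x ⌊v⌋₊) :=
    fun v hv => congrArg x ((Nat.floor_eq_iff (k.cast_nonneg.trans hv.1.le)).2
      ⟨hv.1.le, by exact_mod_cast hv.2⟩).symm
  have hint (k : ℕ) (_ : k < n) :
      IntervalIntegrable (fun v : ℝ => x ⌊v⌋₊) volume k (k + 1 : ℕ) :=
    (intervalIntegrable_const (c := x k)).congr_uIoo (by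
      rw [Set.uIoo_of_le (hle k)]; exact hfloor k)
  rw [← Nat.cast_zero, ← intervalIntegral.sum_integral_adjacent_intervals hint]
  refine Finset.sum_congr rfl fun k _ => ?_
  rw [← intervalIntegral.integral_congr_Ioo_of_le (hle k) (hfloor k)]
  simp

theorem integral_comp_floor_mul [CompleteSpace E] (x : ℕ → E) {n : ℕ} (hn : n ≠ 0) :
    ∫ u in (0 : ℝ)..1, x ⌊n * u⌋₊ = (n : ℝ)⁻¹ • ∑ k ∈ Finset.range n, x k := by
  have hn' : (n : ℝ) ≠ 0 := Nat.cast_ne_zero.2 hn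
  rw [intervalIntegral.integral_comp_mul_left (fun v : ℝ => x ⌊v⌋₊) hn', mul_zero, mul_one,
    integral_comp_floor]

theorem integral_comp_mul_eq_setAverage (y : ℝ → E) {t : ℝ} (ht : 0 < t) :
    ∫ u in (0 : ℝ)..1, y (t * u) = ⨍ s in Set.Icc 0 t, y s := by
  rw [intervalIntegral.integral_comp_mul_left y ht.ne', mul_zero, mul_one,
    intervalIntegral.integral_of_le ht.le, ← integral_Icc_eq_integral_Ioc, setAverage_eq,
    Real.volume_real_Icc_of_le ht.le, sub_zero]

theorem ae_mul_left_of_ae {P : ℝ → Prop} {t : ℝ} (ht : t ≠ 0) (h : ∀ᵐ s, P s) :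
    ∀ᵐ u, P (t * u) := by
  have hquasi : Measure.QuasiMeasurePreserving (t * · : ℝ → ℝ) :=
    ⟨measurable_const_mul t, by
      rw [Real.map_volume_mul_left ht]; exact Measure.smul_absolutelyContinuous⟩
  exact hquasi.ae h

theorem tendsto_average_of_ae_ratioTendsto [CompleteSpace E] {x : ℕ → ℕ → E} {y : ℝ → E}
    {t B : ℝ} (ht : 0 < t) (hB : ∀ n N, ‖x n N‖ ≤ B)
    (h : ∀ᵐ s ∂(volume.restrict (Set.Icc 0 t)), RatioTendsto x s (y s)) :
    Tendsto (fun p : ℕ × ℕ => (p.1 : ℝ)⁻¹ • ∑ k ∈ Finset.range p.1, x k p.2) (ratioAtTop t)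
      (𝓝 (⨍ s in Set.Icc 0 t, y s)) := by
  have hlhs : ∀ᶠ p in ratioAtTop t, ∫ u in (0 : ℝ)..1, x ⌊p.1 * u⌋₊ p.2 =
      (p.1 : ℝ)⁻¹ • ∑ k ∈ Finset.range p.1, x k p.2 := by
    filter_upwards [(tendsto_fst_ratioAtTop t).eventually_ne_atTop 0] with p hp
    exact integral_comp_floor_mul (x · p.2) hp
  rw [← integral_comp_mul_eq_setAverage y ht]
  refine Tendsto.congr' hlhs ?_
  refine intervalIntegral.tendsto_integral_filter_of_dominated_convergence (fun _ => B)
    (Eventually.of_forall fun p => ?_)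
    (Eventually.of_forall fun p => Eventually.of_forall fun u _ => hB _ _)
    intervalIntegrable_const ?_
  · exact (StronglyMeasurable.of_discrete.comp_measurable
      (Nat.measurable_floor.comp (measurable_const_mul _))).aestronglyMeasurable
      (f := (x · p.2) ∘ fun u : ℝ => ⌊p.1 * u⌋₊)
  · filter_upwards [ae_mul_left_of_ae ht.ne' ((ae_restrict_iff' measurableSet_Icc).1 h)]
      with u hu hu01
    rw [Set.uIoc_of_le zero_le_one] at hu01
    have hmem : t * u ∈ Set.Icc 0 t :=
      ⟨mul_nonneg ht.le hu01.1.le, mul_le_of_le_one_right ht.le hu01.2⟩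
    exact (ratioTendsto_iff.1 (hu hmem)).comp (tendsto_floor_mul_ratioAtTop hu01.1)

end Average

section Moments

variable {ι : Type*} {l : Filter ι} {μ : ι → Measure ℂ} {ν : Measure ℂ}

theorem integrable_of_ae_norm_le {V F : Type*} [NormedAddCommGroup V] [ProperSpace V]
    [MeasurableSpace V] [OpensMeasurableSpace V] [NormedAddCommGroup F] {ρ : Measure V}
    [IsFiniteMeasure ρ] {R : ℝ} (hρ : ∀ᵐ z ∂ρ, ‖z‖ ≤ R) {g : V → F} (hg : Continuous g) :
    Integrable g ρ := by
  have h := hg.continuousOn.integrableOn_compact (μ := ρ) (isCompact_closedBall (0 : V) R)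
  rwa [IntegrableOn, Measure.restrict_eq_self_of_ae_mem (by simpa using hρ)] at h

theorem norm_pow_mul_conj_pow_sub_pow_le (d q : ℕ) {z : ℂ} (hz : ‖z‖ ≤ 1) :
    ‖z ^ (d + q) * conj z ^ q - z ^ d‖ ≤ 2 * q * (1 - ‖z‖) := by
  have hfactor : z ^ (d + q) * conj z ^ q - z ^ d = z ^ d * ((‖z‖ ^ (2 * q) - 1 : ℝ) : ℂ) := by
    rw [pow_add, mul_assoc, ← mul_pow, Complex.mul_conj']
    push_cast
    rw [← pow_mul]
    ring
  have hbernoulli : 1 - 2 * q * (1 - ‖z‖) ≤ ‖z‖ ^ (2 * q) := by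
    have := one_add_mul_le_pow (a := ‖z‖ - 1) (by linarith [norm_nonneg z]) (2 * q)
    rw [add_sub_cancel] at this
    push_cast at this
    linarith
  have hle : ‖z‖ ^ (2 * q) ≤ 1 := pow_le_one₀ (norm_nonneg z) hz
  rw [hfactor, norm_mul, norm_pow, Complex.norm_real, Real.norm_eq_abs, abs_sub_comm,
    abs_of_nonneg (sub_nonneg.2 hle)]
  exact (mul_le_of_le_one_left (sub_nonneg.2 hle) (pow_le_one₀ (norm_nonneg z) hz)).trans
    (by linarith)

theorem conj_integral_pow_mul_conj_pow (ρ : Measure ℂ) (p q : ℕ) :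
    conj (∫ z, z ^ p * conj z ^ q ∂ρ) = ∫ z, z ^ q * conj z ^ p ∂ρ := by
  rw [← integral_conj]
  simp only [map_mul, map_pow, Complex.conj_conj, mul_comm]

theorem tendsto_integral_pow_add_mul_conj_pow [∀ i, IsFiniteMeasure (μ i)]
    (hμ : ∀ i, ∀ᵐ z ∂(μ i), ‖z‖ ≤ 1) (hν : ∀ᵐ z ∂ν, ‖z‖ = 1)
    (hr : Tendsto (fun i => ∫ z, (1 - ‖z‖) ∂(μ i)) l (𝓝 0)) {d : ℕ}
    (hm : Tendsto (fun i => ∫ z, z ^ d ∂(μ i)) l (𝓝 (∫ z, z ^ d ∂ν))) (q : ℕ) :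
    Tendsto (fun i => ∫ z, z ^ (d + q) * conj z ^ q ∂(μ i)) l
      (𝓝 (∫ z, z ^ (d + q) * conj z ^ q ∂ν)) := by
  have hνeq : ∫ z, z ^ (d + q) * conj z ^ q ∂ν = ∫ z, z ^ d ∂ν := by
    refine integral_congr_ae (hν.mono fun z hz => ?_)
    have := norm_pow_mul_conj_pow_sub_pow_le d q hz.le
    rw [hz, sub_self, mul_zero] at this
    exact sub_eq_zero.1 (norm_le_zero_iff.1 this)
  have hdiff : Tendsto (fun i => ∫ z, z ^ (d + q) * conj z ^ q ∂(μ i) - ∫ z, z ^ d ∂(μ i)) l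
      (𝓝 0) := by
    refine squeeze_zero_norm (a := fun i => 2 * q * ∫ z, (1 - ‖z‖) ∂(μ i)) (fun i => ?_)
      (by simpa using hr.const_mul (2 * q : ℝ))
    rw [← integral_sub (integrable_of_ae_norm_le (hμ i) (by fun_prop))
      (integrable_of_ae_norm_le (hμ i) (by fun_prop)), ← integral_const_mul]
    exact norm_integral_le_of_norm_le (integrable_of_ae_norm_le (hμ i) (by fun_prop))
      ((hμ i).mono fun z hz => norm_pow_mul_conj_pow_sub_pow_le d q hz)
  rw [hνeq]
  simpa using hdiff.add hm

theorem tendsto_integral_pow_mul_conj_pow [∀ i, IsFiniteMeasure (μ i)]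
    (hμ : ∀ i, ∀ᵐ z ∂(μ i), ‖z‖ ≤ 1) (hν : ∀ᵐ z ∂ν, ‖z‖ = 1)
    (hr : Tendsto (fun i => ∫ z, (1 - ‖z‖) ∂(μ i)) l (𝓝 0))
    (hm : ∀ m : ℕ, Tendsto (fun i => ∫ z, z ^ m ∂(μ i)) l (𝓝 (∫ z, z ^ m ∂ν))) (p q : ℕ) :
    Tendsto (fun i => ∫ z, z ^ p * conj z ^ q ∂(μ i)) l (𝓝 (∫ z, z ^ p * conj z ^ q ∂ν)) := by
  wlog hqp : q ≤ p generalizing p q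
  · simpa only [Function.comp_def, conj_integral_pow_mul_conj_pow] using
      (Complex.continuous_conj.tendsto _).comp (this q p (le_of_not_ge hqp))
  obtain ⟨d, rfl⟩ := Nat.exists_eq_add_of_le' hqp
  exact tendsto_integral_pow_add_mul_conj_pow hμ hν hr (hm d) q

/-- The space of polynomials in `z` and `conj z`, as functions on `ℂ`. -/
def zConjPolynomials : Submodule ℂ (ℂ → ℂ) :=
  Submodule.span ℂ (Set.range fun p : ℕ × ℕ => fun z => z ^ p.1 * conj z ^ p.2)

theorem continuous_of_mem_zConjPolynomials {G : ℂ → ℂ} (hG : G ∈ zConjPolynomials) :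
    Continuous G := by
  induction hG using Submodule.span_induction with
  | mem _ h => obtain ⟨p, rfl⟩ := h; fun_prop
  | zero => exact continuous_const
  | add _ _ _ _ h₁ h₂ => exact h₁.add h₂
  | smul c _ _ h => exact h.const_smul c

theorem exists_zConjPolynomials_norm_sub_lt {K : Set ℂ} (hK : IsCompact K) {f : ℂ → ℂ}
    (hf : ContinuousOn f K) {ε : ℝ} (hε : 0 < ε) :
    ∃ G ∈ zConjPolynomials, ∀ z ∈ K, ‖f z - G z‖ < ε := by
  have : CompactSpace K := isCompact_iff_compactSpace.1 hK
  have hlift : ∀ g ∈ (polynomialFunctions K).starClosure (R := ℂ),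
      ∃ G ∈ zConjPolynomials, ∀ z : K, G z = g z := by
    intro g hg
    rw [polynomialFunctions.starClosure_eq_adjoin_X, ← StarSubalgebra.mem_toSubalgebra,
      StarAlgebra.adjoin_toSubalgebra, ← Subalgebra.mem_toSubmodule, Algebra.adjoin_eq_span,
      Set.star_singleton, Set.singleton_union] at hg
    induction hg using Submodule.span_induction with
    | mem _ h =>
      obtain ⟨p, q, rfl⟩ := Submonoid.mem_closure_pair _ _ _ |>.1 h
      exact ⟨_, Submodule.subset_span ⟨(p, q), rfl⟩, fun z => by simp⟩
    | zero => exact ⟨0, zero_mem _, fun z => rfl⟩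
    | add _ _ _ _ h₁ h₂ =>
      obtain ⟨G, hG, hGz⟩ := h₁
      obtain ⟨H, hH, hHz⟩ := h₂
      exact ⟨G + H, add_mem hG hH, fun z => by simp [hGz, hHz]⟩
    | smul c _ _ h =>
      obtain ⟨G, hG, hGz⟩ := h
      exact ⟨c • G, Submodule.smul_mem _ c hG, fun z => by simp [hGz]⟩
  have hdense : (⟨_, hf.domRestrict⟩ : C(K, ℂ)) ∈
      (polynomialFunctions K).starClosure.topologicalClosure := by
    rw [polynomialFunctions.starClosure_topologicalClosure]
    trivial
  rw [← SetLike.mem_coe, StarSubalgebra.topologicalClosure_coe, Metric.mem_closure_iff] at hdense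
  obtain ⟨g, hg, hdist⟩ := hdense ε hε
  obtain ⟨G, hG, hGg⟩ := hlift g hg
  refine ⟨G, hG, fun z hz => ?_⟩
  have hz' := (ContinuousMap.dist_lt_iff hε).1 hdist ⟨z, hz⟩
  rwa [← hGg, dist_eq_norm] at hz'

theorem tendsto_integral_of_mem_zConjPolynomials [∀ i, IsFiniteMeasure (μ i)] [IsFiniteMeasure ν]
    (hμ : ∀ i, ∀ᵐ z ∂(μ i), ‖z‖ ≤ 1) (hν : ∀ᵐ z ∂ν, ‖z‖ ≤ 1)
    (hm : ∀ p q : ℕ, Tendsto (fun i => ∫ z, z ^ p * conj z ^ q ∂(μ i)) l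
      (𝓝 (∫ z, z ^ p * conj z ^ q ∂ν))) {G : ℂ → ℂ} (hG : G ∈ zConjPolynomials) :
    Tendsto (fun i => ∫ z, G z ∂(μ i)) l (𝓝 (∫ z, G z ∂ν)) := by
  induction hG using Submodule.span_induction with
  | mem _ h => obtain ⟨p, rfl⟩ := h; exact hm p.1 p.2
  | zero => simp [tendsto_const_nhds]
  | add G H hG hH h₁ h₂ =>
    have hGc := continuous_of_mem_zConjPolynomials hG
    have hHc := continuous_of_mem_zConjPolynomials hH
    simp only [Pi.add_apply, integral_add (integrable_of_ae_norm_le (hμ _) hGc)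
        (integrable_of_ae_norm_le (hμ _) hHc),
      integral_add (integrable_of_ae_norm_le hν hGc) (integrable_of_ae_norm_le hν hHc)]
    exact h₁.add h₂
  | smul c G _ h =>
    simp only [Pi.smul_apply, integral_smul]
    exact h.const_smul c

theorem norm_integral_sub_integral_le {ρ : Measure ℂ} [IsZeroOrProbabilityMeasure ρ]
    (hρ : ∀ᵐ z ∂ρ, ‖z‖ ≤ 1) {f G : ℂ → ℂ} (hf : Continuous f) (hG : Continuous G) {ε : ℝ}
    (hε : 0 ≤ ε) (h : ∀ z, ‖z‖ ≤ 1 → ‖f z - G z‖ ≤ ε) :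
    ‖∫ z, f z ∂ρ - ∫ z, G z ∂ρ‖ ≤ ε := by
  rw [← integral_sub (integrable_of_ae_norm_le hρ hf) (integrable_of_ae_norm_le hρ hG)]
  exact (norm_integral_le_of_norm_le_const (hρ.mono h)).trans
    (mul_le_of_le_one_right hε measureReal_le_one)

theorem tendsto_of_forall_exists_tendsto_norm_sub_le {F : Type*} [SeminormedAddCommGroup F]
    {u : ι → F} {a : F}
    (h : ∀ ε > 0, ∃ v : ι → F, ∃ b, Tendsto v l (𝓝 b) ∧ (∀ i, ‖u i - v i‖ ≤ ε) ∧ ‖a - b‖ ≤ ε) :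
    Tendsto u l (𝓝 a) := by
  refine Metric.tendsto_nhds.2 fun ε hε => ?_
  obtain ⟨v, b, hv, huv, hab⟩ := h (ε / 3) (by positivity)
  filter_upwards [Metric.tendsto_nhds.1 hv (ε / 3) (by positivity)] with i hi
  calc dist (u i) a ≤ dist (u i) (v i) + dist (v i) b + dist b a := dist_triangle4 _ _ _ _
    _ < ε / 3 + ε / 3 + ε / 3 := by
      refine add_lt_add_of_lt_of_le (add_lt_add_of_le_of_lt ?_ hi) ?_
      · rw [dist_eq_norm]; exact huv i
      · rw [dist_comm, dist_eq_norm]; exact hab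
    _ = ε := by ring

theorem tendsto_integral_of_tendsto_moments [∀ i, IsZeroOrProbabilityMeasure (μ i)]
    [IsZeroOrProbabilityMeasure ν] (hμ : ∀ i, ∀ᵐ z ∂(μ i), ‖z‖ ≤ 1) (hν : ∀ᵐ z ∂ν, ‖z‖ = 1)
    (hr : Tendsto (fun i => ∫ z, (1 - ‖z‖) ∂(μ i)) l (𝓝 0))
    (hm : ∀ m : ℕ, Tendsto (fun i => ∫ z, z ^ m ∂(μ i)) l (𝓝 (∫ z, z ^ m ∂ν)))
    {f : ℂ → ℂ} (hf : Continuous f) :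
    Tendsto (fun i => ∫ z, f z ∂(μ i)) l (𝓝 (∫ z, f z ∂ν)) := by
  have hν' : ∀ᵐ z ∂ν, ‖z‖ ≤ 1 := hν.mono fun z hz => hz.le
  refine tendsto_of_forall_exists_tendsto_norm_sub_le fun ε hε => ?_
  obtain ⟨G, hG, hfG⟩ := exists_zConjPolynomials_norm_sub_lt (isCompact_closedBall (0 : ℂ) 1)
    hf.continuousOn hε
  have hGc := continuous_of_mem_zConjPolynomials hG
  have hclose (z : ℂ) (hz : ‖z‖ ≤ 1) : ‖f z - G z‖ ≤ ε := (hfG z (by simpa using hz)).le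
  exact ⟨_, _, tendsto_integral_of_mem_zConjPolynomials hμ hν'
      (tendsto_integral_pow_mul_conj_pow hμ hν hr hm) hG,
    fun i => norm_integral_sub_integral_le (hμ i) hf hGc hε.le hclose,
    norm_integral_sub_integral_le hν' hf hGc hε.le hclose⟩

theorem tendsto_integral_real_of_tendsto_moments [∀ i, IsZeroOrProbabilityMeasure (μ i)]
    [IsZeroOrProbabilityMeasure ν] (hμ : ∀ i, ∀ᵐ z ∂(μ i), ‖z‖ ≤ 1) (hν : ∀ᵐ z ∂ν, ‖z‖ = 1)
    (hr : Tendsto (fun i => ∫ z, (1 - ‖z‖) ∂(μ i)) l (𝓝 0))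
    (hm : ∀ m : ℕ, Tendsto (fun i => ∫ z, z ^ m ∂(μ i)) l (𝓝 (∫ z, z ^ m ∂ν)))
    {f : ℂ → ℝ} (hf : Continuous f) :
    Tendsto (fun i => ∫ z, f z ∂(μ i)) l (𝓝 (∫ z, f z ∂ν)) := by
  have hcomplex := tendsto_integral_of_tendsto_moments hμ hν hr hm
    (Complex.continuous_ofReal.comp hf)
  simp only [Function.comp_apply, integral_complex_ofReal] at hcomplex
  exact (Complex.continuous_re.tendsto _).comp hcomplex

end Moments

section ArcMeasure

variable {a : ℝ}

/-- The uniform probability measure on the half circle of angles `(0, π)`. -/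
noncomputable def halfCircleMeasure : Measure ℝ := ProbabilityTheory.cond volume (Set.Ioo 0 Real.pi)

theorem halfCircleMeasure_eq_smul :
    halfCircleMeasure = ENNReal.ofReal Real.pi⁻¹ • volume.restrict (Set.Ioo 0 Real.pi) := by
  rw [halfCircleMeasure, ProbabilityTheory.cond, Real.volume_Ioo, sub_zero,
    ENNReal.ofReal_inv_of_pos Real.pi_pos]

instance : IsProbabilityMeasure halfCircleMeasure :=
  ProbabilityTheory.cond_isProbabilityMeasure_of_finite (by simp [Real.pi_pos]) (by simp)

theorem integral_halfCircleMeasure {E : Type*} [NormedAddCommGroup E] [NormedSpace ℝ E]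
    (g : ℝ → E) : ∫ φ, g φ ∂halfCircleMeasure = Real.pi⁻¹ • ∫ φ in (0 : ℝ)..Real.pi, g φ := by
  rw [halfCircleMeasure_eq_smul, integral_smul_measure,
    ENNReal.toReal_ofReal (inv_nonneg.2 Real.pi_pos.le),
    intervalIntegral.integral_of_le Real.pi_pos.le, integral_Ioc_eq_integral_Ioo]

theorem integrable_halfCircleMeasure {E : Type*} [NormedAddCommGroup E] {g : ℝ → E}
    (hg : Continuous g) : Integrable g halfCircleMeasure := by
  rw [halfCircleMeasure_eq_smul]
  exact ((hg.integrableOn_Icc).mono_set Set.Ioo_subset_Icc_self).integrable.smul_measure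
    ENNReal.ofReal_ne_top

theorem integral_add_comp_pi_sub_halfCircleMeasure {E : Type*} [NormedAddCommGroup E]
    [NormedSpace ℝ E] {g : ℝ → E} (hg : Continuous g) :
    ∫ φ, (g φ + g (Real.pi - φ)) ∂halfCircleMeasure = (2 : ℝ) • ∫ φ, g φ ∂halfCircleMeasure := by
  have hg' : Continuous fun φ => g (Real.pi - φ) := by fun_prop
  rw [integral_add (integrable_halfCircleMeasure hg) (integrable_halfCircleMeasure hg'), two_smul]
  congr 1
  simp only [integral_halfCircleMeasure, intervalIntegral.integral_comp_sub_left, sub_self,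
    sub_zero]

theorem integral_comp_exp_two_mul_I_halfCircleMeasure {E : Type*} [NormedAddCommGroup E]
    [NormedSpace ℂ E] [CompleteSpace E] {F : ℂ → E} (hF : Differentiable ℂ F) :
    ∫ φ : ℝ, F (Complex.exp (2 * φ * Complex.I)) ∂halfCircleMeasure = F 0 := by
  have hmean : Real.circleAverage F 0 1 = F 0 := hF.diffContOnCl.circleAverage
  have hsubst := intervalIntegral.integral_comp_mul_left (a := 0) (b := Real.pi)
    (fun θ : ℝ => F (circleMap 0 1 θ)) two_ne_zero
  have hu (φ : ℝ) : Complex.exp (2 * φ * Complex.I) = circleMap 0 1 (2 * φ) := by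
    simp [circleMap]
  simp only [hu]
  rw [integral_halfCircleMeasure, hsubst, mul_zero, smul_smul, ← hmean, Real.circleAverage_def,
    mul_inv_rev]

/-- The substitution `cos (θ / 2) = √(1 - a ^ 2) * cos φ`, solved for `θ`. It carries the uniform
distribution of `φ` on `(0, π)` to the equilibrium measure of the arc `Γ_a`. -/
noncomputable def arcParam (a φ : ℝ) : ℝ := 2 * Real.arccos (√(1 - a ^ 2) * Real.cos φ)

theorem continuous_arcParam (a : ℝ) : Continuous (arcParam a) := by
  unfold arcParam
  fun_prop

theorem sqrt_one_sub_sq_mul_cos_mem_Icc (a φ : ℝ) :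
    √(1 - a ^ 2) * Real.cos φ ∈ Set.Icc (-1 : ℝ) 1 := by
  rw [Set.mem_Icc, ← abs_le, abs_mul, abs_of_nonneg (Real.sqrt_nonneg _)]
  exact mul_le_one₀ (Real.sqrt_le_one.2 (by linarith [sq_nonneg a])) (abs_nonneg _)
    (Real.abs_cos_le_one φ)

theorem cos_arcParam_div_two (a φ : ℝ) :
    Real.cos (arcParam a φ / 2) = √(1 - a ^ 2) * Real.cos φ := by
  have h := sqrt_one_sub_sq_mul_cos_mem_Icc a φ
  rw [arcParam, mul_div_cancel_left₀ _ two_ne_zero, Real.cos_arccos h.1 h.2]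

theorem arcParam_pi_sub (a φ : ℝ) : arcParam a (Real.pi - φ) = 2 * Real.pi - arcParam a φ := by
  rw [arcParam, arcParam, Real.cos_pi_sub, mul_neg, Real.arccos_neg, mul_sub]

theorem arcParam_zero (ha : 0 ≤ a) : arcParam a 0 = arcAngle a := by
  rw [arcParam, arcAngle, Real.cos_zero, mul_one, Real.arcsin_eq_arccos ha]

theorem arcParam_pi (ha : 0 ≤ a) : arcParam a Real.pi = 2 * Real.pi - arcAngle a := by
  simpa [arcParam_zero ha] using arcParam_pi_sub a 0

theorem strictMonoOn_arcParam (ha : a ^ 2 < 1) :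
    StrictMonoOn (arcParam a) (Set.Icc 0 Real.pi) := by
  intro φ hφ ψ hψ hlt
  have hcos := mul_lt_mul_of_pos_left (Real.strictAntiOn_cos hφ hψ hlt)
    (Real.sqrt_pos.2 (sub_pos.2 ha))
  exact mul_lt_mul_of_pos_left (Real.strictAntiOn_arccos (sqrt_one_sub_sq_mul_cos_mem_Icc a ψ)
    (sqrt_one_sub_sq_mul_cos_mem_Icc a φ) hcos) two_pos

theorem image_arcParam_Ioo (ha : 0 ≤ a) (ha1 : a < 1) :
    arcParam a '' Set.Ioo 0 Real.pi = Set.Ioo (arcAngle a) (2 * Real.pi - arcAngle a) := by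
  rw [(continuous_arcParam a).continuousOn.image_Ioo_of_strictMonoOn Real.pi_pos.le
    (strictMonoOn_arcParam (pow_lt_one₀ ha ha1 two_ne_zero)), arcParam_zero ha, arcParam_pi ha]

theorem sqrt_one_sub_sq_mul_cos_mem_Ioo (a : ℝ) {φ : ℝ} (hφ : φ ∈ Set.Ioo 0 Real.pi) :
    √(1 - a ^ 2) * Real.cos φ ∈ Set.Ioo (-1 : ℝ) 1 := by
  have hcos : |Real.cos φ| < 1 := by
    rw [← sq_lt_one_iff_abs_lt_one, Real.cos_sq']
    linarith [pow_pos (Real.sin_pos_of_mem_Ioo hφ) 2]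
  rw [Set.mem_Ioo, ← abs_lt, abs_mul, abs_of_nonneg (Real.sqrt_nonneg _)]
  exact (mul_le_of_le_one_left (abs_nonneg _)
    (Real.sqrt_le_one.2 (by linarith [sq_nonneg a]))).trans_lt hcos

theorem hasDerivAt_arcParam (a : ℝ) {φ : ℝ} (hφ : φ ∈ Set.Ioo 0 Real.pi) :
    HasDerivAt (arcParam a)
      (2 * (√(1 - a ^ 2) * Real.sin φ / √(1 - (√(1 - a ^ 2) * Real.cos φ) ^ 2))) φ := by
  obtain ⟨hgt, hlt⟩ := sqrt_one_sub_sq_mul_cos_mem_Ioo a hφ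
  have hinner := (Real.hasDerivAt_cos φ).const_mul √(1 - a ^ 2)
  convert! ((Real.hasDerivAt_arccos hgt.ne' hlt.ne).comp φ hinner).const_mul 2 using 1
  ring

theorem deriv_arcParam_mul_arcDensity (ha : a ^ 2 < 1) {φ : ℝ} (hφ : φ ∈ Set.Ioo 0 Real.pi) :
    2 * (√(1 - a ^ 2) * Real.sin φ / √(1 - (√(1 - a ^ 2) * Real.cos φ) ^ 2)) *
      arcDensity a (arcParam a φ) = Real.pi⁻¹ := by
  obtain ⟨hgt, hlt⟩ := sqrt_one_sub_sq_mul_cos_mem_Ioo a hφ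
  have hc : 0 < √(1 - a ^ 2) := Real.sqrt_pos.2 (sub_pos.2 ha)
  have hsin := Real.sin_pos_of_mem_Ioo hφ
  have hsin_half : Real.sin (arcParam a φ / 2) = √(1 - (√(1 - a ^ 2) * Real.cos φ) ^ 2) := by
    rw [arcParam, mul_div_cancel_left₀ _ two_ne_zero, Real.sin_arccos]
  have hcos_angle : Real.cos (arcAngle a / 2) = √(1 - a ^ 2) := by
    rw [arcAngle, mul_div_cancel_left₀ _ two_ne_zero, Real.cos_arcsin]
  have hden : √(√(1 - a ^ 2) ^ 2 - (√(1 - a ^ 2) * Real.cos φ) ^ 2) =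
      √(1 - a ^ 2) * Real.sin φ := by
    rw [← Real.sqrt_sq (mul_pos hc hsin).le, mul_pow, mul_pow, Real.sin_sq]
    ring_nf
  have hpos : 0 < √(1 - (√(1 - a ^ 2) * Real.cos φ) ^ 2) :=
    Real.sqrt_pos.2 (sub_pos.2 ((sq_lt_one_iff_abs_lt_one _).2 (abs_lt.2 ⟨hgt, hlt⟩)))
  rw [arcDensity, hsin_half, hcos_angle, cos_arcParam_div_two, hden]
  generalize √(1 - (√(1 - a ^ 2) * Real.cos φ) ^ 2) = R at hpos ⊢
  field_simp

theorem withDensity_restrict_image_eq_smul_map {s : Set ℝ} {T T' : ℝ → ℝ} {ρ : ℝ → ℝ≥0∞}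
    {κ : ℝ≥0∞} (hs : MeasurableSet s) (hT : Measurable T)
    (hT' : ∀ φ ∈ s, HasDerivWithinAt T (T' φ) s φ) (hinj : Set.InjOn T s)
    (hκ : ∀ φ ∈ s, ENNReal.ofReal |T' φ| * ρ (T φ) = κ) :
    (volume.restrict (T '' s)).withDensity ρ = κ • (volume.restrict s).map T := by
  ext B hB
  calc (volume.restrict (T '' s)).withDensity ρ B
    _ = ∫⁻ θ in T '' s, B.indicator ρ θ := by rw [withDensity_apply _ hB, lintegral_indicator hB]
    _ = ∫⁻ φ in s, ENNReal.ofReal |T' φ| * B.indicator ρ (T φ) :=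
      lintegral_image_eq_lintegral_abs_deriv_mul hs hT' hinj _
    _ = ∫⁻ φ in s, (T ⁻¹' B).indicator (fun _ => κ) φ := by
      refine setLIntegral_congr_fun hs fun φ hφ => ?_
      by_cases h : T φ ∈ B
      · simp [h, hκ φ hφ]
      · simp [h]
    _ = (κ • (volume.restrict s).map T) B := by
      rw [lintegral_indicator_const (hT hB), Measure.smul_apply, Measure.map_apply hT hB,
        smul_eq_mul]

theorem withDensity_arcDensity (ha : 0 ≤ a) (ha1 : a < 1) :
    (volume.restrict (Set.Icc (arcAngle a) (2 * Real.pi - arcAngle a))).withDensity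
      (fun θ => ENNReal.ofReal (arcDensity a θ)) = halfCircleMeasure.map (arcParam a) := by
  have ha2 : a ^ 2 < 1 := pow_lt_one₀ ha ha1 two_ne_zero
  rw [Measure.restrict_congr_set Ioo_ae_eq_Icc.symm, ← image_arcParam_Ioo ha ha1,
    halfCircleMeasure_eq_smul, Measure.map_smul]
  refine withDensity_restrict_image_eq_smul_map measurableSet_Ioo
    (continuous_arcParam a).measurable (fun φ hφ => (hasDerivAt_arcParam a hφ).hasDerivWithinAt)
    ((strictMonoOn_arcParam ha2).injOn.mono Set.Ioo_subset_Icc_self) fun φ hφ => ?_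
  have hsin := Real.sin_pos_of_mem_Ioo hφ
  rw [abs_of_nonneg (by positivity), ← ENNReal.ofReal_mul (by positivity),
    deriv_arcParam_mul_arcDensity ha2 hφ]

/-- The point `e^{iθ}` of the arc `Γ_a` at `θ = arcParam a φ`. -/
noncomputable def arcPoint (a φ : ℝ) : ℂ := Complex.exp (arcParam a φ * Complex.I)

theorem continuous_arcPoint (a : ℝ) : Continuous (arcPoint a) := by
  have := continuous_arcParam a
  unfold arcPoint
  fun_prop

theorem arcPoint_ne_zero (a φ : ℝ) : arcPoint a φ ≠ 0 := Complex.exp_ne_zero _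

theorem arcPoint_one (φ : ℝ) : arcPoint 1 φ = -1 := by
  have hparam : arcParam 1 φ = Real.pi := by simp [arcParam, mul_div_cancel₀]
  rw [arcPoint, hparam, Complex.exp_pi_mul_I]

theorem arcPoint_pi_sub (a φ : ℝ) : arcPoint a (Real.pi - φ) = (arcPoint a φ)⁻¹ := by
  have hexp : ((2 * Real.pi - arcParam a φ : ℝ) : ℂ) * Complex.I =
      2 * Real.pi * Complex.I - arcParam a φ * Complex.I := by push_cast; ring
  rw [arcPoint, arcPoint, arcParam_pi_sub, hexp, Complex.exp_sub, Complex.exp_two_pi_mul_I,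
    one_div]

theorem exp_mul_I_add_inv (x : ℂ) :
    Complex.exp (x * Complex.I) + (Complex.exp (x * Complex.I))⁻¹ = 2 * Complex.cos x := by
  rw [Complex.two_cos, ← Complex.exp_neg, neg_mul]

theorem arcPoint_add_inv (ha : a ^ 2 ≤ 1) (φ : ℝ) :
    arcPoint a φ + (arcPoint a φ)⁻¹ = (1 - (a : ℂ) ^ 2) *
      (Complex.exp (2 * φ * Complex.I) + (Complex.exp (2 * φ * Complex.I))⁻¹ + 2) - 2 := by
  have hcos : Real.cos (arcParam a φ) = (1 - a ^ 2) * (Real.cos (2 * φ) + 1) - 1 := by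
    rw [← mul_div_cancel₀ (arcParam a φ) (two_ne_zero' ℝ), Real.cos_two_mul, Real.cos_two_mul,
      cos_arcParam_div_two, mul_pow, Real.sq_sqrt (sub_nonneg.2 ha)]
    ring
  rw [arcPoint, exp_mul_I_add_inv, exp_mul_I_add_inv, ← Complex.ofReal_cos, hcos]
  push_cast
  ring

theorem arcMeasure_eq_map_arcPoint (ha : 0 ≤ a) (ha1 : a ≤ 1) :
    arcMeasure a = halfCircleMeasure.map (arcPoint a) := by
  rcases ha1.eq_or_lt with rfl | ha1
  · rw [arcMeasure, if_pos rfl, funext arcPoint_one, Measure.map_const, measure_univ, one_smul]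
  · rw [arcMeasure, if_neg ha1.ne, withDensity_arcDensity ha ha1,
      Measure.map_map (by fun_prop) (continuous_arcParam a).measurable]
    rfl

theorem isProbabilityMeasure_arcMeasure (ha : 0 ≤ a) (ha1 : a ≤ 1) :
    IsProbabilityMeasure (arcMeasure a) := by
  rw [arcMeasure_eq_map_arcPoint ha ha1]
  exact Measure.isProbabilityMeasure_map (continuous_arcPoint a).aemeasurable

theorem ae_norm_eq_one_arcMeasure (ha : 0 ≤ a) (ha1 : a ≤ 1) : ∀ᵐ z ∂(arcMeasure a), ‖z‖ = 1 := by
  rw [arcMeasure_eq_map_arcPoint ha ha1, ae_map_iff (continuous_arcPoint a).aemeasurable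
    (measurableSet_eq_fun measurable_norm measurable_const)]
  exact Eventually.of_forall fun φ => Complex.norm_exp_ofReal_mul_I _

theorem integral_arcMeasure {E : Type*} [NormedAddCommGroup E] [NormedSpace ℝ E]
    (ha : 0 ≤ a) (ha1 : a ≤ 1) {g : ℂ → E} (hg : StronglyMeasurable g) :
    ∫ z, g z ∂(arcMeasure a) = ∫ φ, g (arcPoint a φ) ∂halfCircleMeasure := by
  rw [arcMeasure_eq_map_arcPoint ha ha1,
    integral_map (continuous_arcPoint a).aemeasurable hg.aestronglyMeasurable]

end ArcMeasure

section ArcMoments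

variable {α : ℂ}

/-- The ratio `r` for which `limitRatio α * (1 + u * r)` and `limitRatio α * (1 + u⁻¹ * r)`,
with `u = e^{2iφ}`, multiply to the polynomial whose reciprocal zeros are the two conjugate points
`arcPoint ‖α‖ φ` and `arcPoint ‖α‖ (π - φ)`. -/
noncomputable def limitRatioDefect (α : ℂ) : ℂ⟦X⟧ :=
  (limitRatio α - (1 + PowerSeries.X)) * (limitRatio α)⁻¹

theorem constantCoeff_limitRatioDefect (α : ℂ) :
    PowerSeries.constantCoeff (limitRatioDefect α) = 0 := by
  simp [limitRatioDefect]

theorem limitRatio_mul_limitRatioDefect (α : ℂ) :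
    limitRatio α * limitRatioDefect α = limitRatio α - (1 + PowerSeries.X) := by
  rw [limitRatioDefect, mul_left_comm, PowerSeries.mul_inv_cancel _ (by simp), mul_one]

theorem one_sub_C_mul_X_mul_one_sub_C_inv_mul_X {E u : ℂ} (hE : E ≠ 0) (hu : u ≠ 0)
    (h : E + E⁻¹ = (1 - (‖α‖ : ℂ) ^ 2) * (u + u⁻¹ + 2) - 2) :
    (1 - PowerSeries.C E * PowerSeries.X) * (1 - PowerSeries.C E⁻¹ * PowerSeries.X) =
      limitRatio α * limitRatio α * ((1 + PowerSeries.C u * limitRatioDefect α) *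
        (1 + PowerSeries.C u⁻¹ * limitRatioDefect α)) := by
  have hEE : PowerSeries.C E * PowerSeries.C E⁻¹ = 1 := by
    rw [← map_mul, mul_inv_cancel₀ hE, map_one]
  have huu : PowerSeries.C u * PowerSeries.C u⁻¹ = 1 := by
    rw [← map_mul, mul_inv_cancel₀ hu, map_one]
  have hC : PowerSeries.C E + PowerSeries.C E⁻¹ = PowerSeries.C (1 - (‖α‖ : ℂ) ^ 2) *
      (PowerSeries.C u + PowerSeries.C u⁻¹ + 2) - 2 := by
    rw [← map_add, h]
    simp only [map_add, map_sub, map_mul, map_ofNat]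
  set q := limitRatio α - (1 + PowerSeries.X) with hq
  have hrq : limitRatio α * limitRatioDefect α = q := limitRatio_mul_limitRatioDefect α
  calc (1 - PowerSeries.C E * PowerSeries.X) * (1 - PowerSeries.C E⁻¹ * PowerSeries.X)
    _ = (limitRatio α + PowerSeries.C u * q) * (limitRatio α + PowerSeries.C u⁻¹ * q) := by
      linear_combination PowerSeries.X ^ 2 * hEE - PowerSeries.X * hC - q ^ 2 * huu -
        (PowerSeries.C u + PowerSeries.C u⁻¹ + 2) * limitRatio_mul_sub α +
        (limitRatio α - q + 1 + PowerSeries.X) * hq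
    _ = _ := by rw [← hrq]; ring

theorem pow_add_inv_pow_eq_coeff_negLogDeriv {E u : ℂ} (hE : E ≠ 0) (hu : u ≠ 0)
    (h : E + E⁻¹ = (1 - (‖α‖ : ℂ) ^ 2) * (u + u⁻¹ + 2) - 2) {m : ℕ} (hm : m ≠ 0) :
    E ^ m + E⁻¹ ^ m = 2 * PowerSeries.coeff m (negLogDeriv (limitRatio α)) +
      (PowerSeries.coeff m (negLogDeriv (1 + PowerSeries.C u * limitRatioDefect α)) +
        PowerSeries.coeff m (negLogDeriv (1 + PowerSeries.C u⁻¹ * limitRatioDefect α))) := by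
  have hr := constantCoeff_limitRatioDefect α
  have hcoeff := congrArg (fun f => PowerSeries.coeff m (negLogDeriv f))
    (one_sub_C_mul_X_mul_one_sub_C_inv_mul_X hE hu h)
  simp only [negLogDeriv_mul, map_add, map_sub, map_mul, map_one, constantCoeff_limitRatio, hr,
    PowerSeries.constantCoeff_X, mul_zero, sub_zero, add_zero, mul_one, ne_eq, one_ne_zero,
    not_false_eq_true, coeff_negLogDeriv_one_sub_C_mul_X _ hm] at hcoeff
  rw [hcoeff, two_mul]

theorem integral_pow_arcMeasure_norm (hα : ‖α‖ ≤ 1) {m : ℕ} (hm : m ≠ 0) :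
    ∫ z, z ^ m ∂(arcMeasure ‖α‖) = PowerSeries.coeff m (negLogDeriv (limitRatio α)) := by
  set K := PowerSeries.coeff m (negLogDeriv (limitRatio α))
  set F : ℂ → ℂ := fun u =>
    PowerSeries.coeff m (negLogDeriv (1 + PowerSeries.C u * limitRatioDefect α)) with hFdef
  have hF : Differentiable ℂ F :=
    differentiable_coeff_negLogDeriv (by simp [constantCoeff_limitRatioDefect])
      (fun k => by simp only [map_add, PowerSeries.coeff_C_mul]; fun_prop) m
  have hF0 : F 0 = 0 := by simp [hFdef]
  set u : ℝ → ℂ := fun φ => Complex.exp (2 * φ * Complex.I)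
  have hreflect (φ : ℝ) : u (Real.pi - φ) = (u φ)⁻¹ := by
    rw [← Complex.exp_neg, Complex.exp_eq_exp_iff_exists_int]
    exact ⟨1, by push_cast; ring⟩
  have hsplit (φ : ℝ) : arcPoint ‖α‖ φ ^ m + arcPoint ‖α‖ (Real.pi - φ) ^ m =
      2 * K + (F (u φ) + F (u (Real.pi - φ))) := by
    rw [arcPoint_pi_sub, hreflect]
    exact pow_add_inv_pow_eq_coeff_negLogDeriv (arcPoint_ne_zero _ _) (Complex.exp_ne_zero _)
      (arcPoint_add_inv (pow_le_one₀ (norm_nonneg α) hα) φ) hm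
  have hFu : Continuous fun φ => F (u φ) := hF.continuous.comp (by fun_prop)
  have hFsum : Integrable (fun φ => F (u φ) + F (u (Real.pi - φ))) halfCircleMeasure :=
    integrable_halfCircleMeasure (hFu.add (hFu.comp (continuous_const.sub continuous_id)))
  have hdouble := integral_congr_ae (μ := halfCircleMeasure) (Eventually.of_forall hsplit)
  rw [integral_add_comp_pi_sub_halfCircleMeasure (g := fun φ => arcPoint ‖α‖ φ ^ m)
      ((continuous_arcPoint ‖α‖).pow m),
    integral_add (integrable_const _) hFsum, integral_add_comp_pi_sub_halfCircleMeasure hFu,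
    integral_comp_exp_two_mul_I_halfCircleMeasure hF, hF0, smul_zero, add_zero, integral_const,
    probReal_univ, one_smul, Complex.real_smul, Complex.ofReal_ofNat] at hdouble
  rw [integral_arcMeasure (norm_nonneg α) hα (continuous_pow m).stronglyMeasurable]
  exact mul_left_cancel₀ two_ne_zero hdouble

end ArcMoments

section ZeroMeasure

section SumDirac

variable {X : Type*} [MeasurableSpace X]

theorem sum_map_dirac_univ (s : Multiset X) :
    (s.map Measure.dirac).sum Set.univ = (s.card : ℝ≥0∞) := by
  induction s using Multiset.induction_on with
  | empty => simp
  | cons w s ih => simp [ih, add_comm]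

theorem ae_sum_map_dirac [MeasurableSingletonClass X] {s : Multiset X} {P : X → Prop}
    (h : ∀ z ∈ s, P z) : ∀ᵐ z ∂(s.map Measure.dirac).sum, P z := by
  induction s using Multiset.induction_on with
  | empty => simp
  | cons w s ih =>
    rw [Multiset.map_cons, Multiset.sum_cons, ae_add_measure_iff, ae_dirac_eq]
    exact ⟨h w (s.mem_cons_self w), ih fun z hz => h z (Multiset.mem_cons_of_mem hz)⟩

variable [MeasurableSingletonClass X] {E : Type*} [NormedAddCommGroup E]

theorem integrable_sum_map_dirac (f : X → E) (s : Multiset X) :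
    Integrable f (s.map Measure.dirac).sum := by
  induction s using Multiset.induction_on with
  | empty => simp
  | cons w s ih =>
    rw [Multiset.map_cons, Multiset.sum_cons]
    exact (integrable_dirac enorm_lt_top).add_measure ih

theorem integral_sum_map_dirac [NormedSpace ℝ E] [CompleteSpace E] (f : X → E) (s : Multiset X) :
    ∫ z, f z ∂(s.map Measure.dirac).sum = (s.map f).sum := by
  induction s using Multiset.induction_on with
  | empty => simp
  | cons w s ih =>
    rw [Multiset.map_cons, Multiset.sum_cons, Multiset.map_cons, Multiset.sum_cons,
      integral_add_measure (integrable_dirac enorm_lt_top) (integrable_sum_map_dirac f s), ih,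
      integral_dirac]

end SumDirac

variable {a : ℕ → ℂ}

theorem integral_opucZeroMeasure {E : Type*} [NormedAddCommGroup E] [NormedSpace ℝ E]
    [CompleteSpace E] (f : ℂ → E) (a : ℕ → ℂ) (n : ℕ) :
    ∫ z, f z ∂(opucZeroMeasure a n) = (n : ℝ)⁻¹ • ((opuc a n).roots.map f).sum := by
  rw [opucZeroMeasure, integral_smul_measure, integral_sum_map_dirac, ENNReal.toReal_inv,
    ENNReal.toReal_natCast]

theorem opucZeroMeasure_univ (a : ℕ → ℂ) {n : ℕ} (hn : n ≠ 0) :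
    opucZeroMeasure a n Set.univ = 1 := by
  rw [opucZeroMeasure, Measure.smul_apply, sum_map_dirac_univ, card_roots_opuc, smul_eq_mul,
    ENNReal.inv_mul_cancel (by simpa) (ENNReal.natCast_ne_top n)]

instance isZeroOrProbabilityMeasure_opucZeroMeasure (a : ℕ → ℂ) (n : ℕ) :
    IsZeroOrProbabilityMeasure (opucZeroMeasure a n) := by
  obtain rfl | hn := eq_or_ne n 0
  · exact ⟨Or.inl (by simp [opucZeroMeasure, opuc])⟩
  · exact ⟨Or.inr (opucZeroMeasure_univ a hn)⟩

theorem ae_norm_le_one_opucZeroMeasure (ha : ∀ n, ‖a n‖ ≤ 1) (n : ℕ) :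
    ∀ᵐ z ∂(opucZeroMeasure a n), ‖z‖ ≤ 1 :=
  Measure.ae_smul_measure (ae_sum_map_dirac fun _ hz => norm_le_one_of_mem_roots_opuc ha hz) _

theorem prod_le_exp_neg_sum_one_sub {s : Multiset ℝ} (hs : ∀ x ∈ s, 0 ≤ x) :
    s.prod ≤ Real.exp (-(s.map (1 - ·)).sum) := by
  rw [← Multiset.sum_map_neg, Real.exp_multiset_sum, Multiset.map_map]
  nth_rw 1 [← Multiset.map_id s]
  refine Multiset.prod_map_le_prod_map₀ _ _ hs fun x _ => ?_
  simpa using Real.add_one_le_exp (x - 1)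

theorem norm_rpow_le_exp_neg_integral_one_sub_norm (a : ℕ → ℂ) {n : ℕ} (hn : n ≠ 0) :
    ‖a (n - 1)‖ ^ (1 / (n : ℝ)) ≤ Real.exp (-∫ z, (1 - ‖z‖) ∂(opucZeroMeasure a n)) := by
  obtain ⟨k, rfl⟩ := Nat.exists_eq_succ_of_ne_zero hn
  have hprod := prod_le_exp_neg_sum_one_sub (s := (opuc a (k + 1)).roots.map norm)
    (Multiset.forall_mem_map_iff.2 fun z _ => norm_nonneg z)
  rw [prod_norm_roots_opuc_succ, Multiset.map_map] at hprod
  calc ‖a k‖ ^ (1 / ((k + 1 : ℕ) : ℝ))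
    _ ≤ Real.exp (-((opuc a (k + 1)).roots.map ((1 - ·) ∘ norm)).sum) ^
        (1 / ((k + 1 : ℕ) : ℝ)) := Real.rpow_le_rpow (norm_nonneg _) hprod (by positivity)
    _ = Real.exp (-∫ z, (1 - ‖z‖) ∂(opucZeroMeasure a (k + 1))) := by
      rw [← Real.exp_mul, integral_opucZeroMeasure, smul_eq_mul, one_div, neg_mul, mul_comm]
      rfl

variable {a : ℕ → ℕ → ℂ} {t : ℝ}

theorem tendsto_integral_one_sub_norm_opucZeroMeasure (ha : ∀ n N, ‖a n N‖ ≤ 1)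
    (hroot : RatioTendsto (fun n N => ‖a (n - 1) N‖ ^ (1 / (n : ℝ))) t 1) :
    Tendsto (fun p : ℕ × ℕ => ∫ z, (1 - ‖z‖) ∂(opucZeroMeasure (a · p.2) p.1)) (ratioAtTop t)
      (𝓝 0) := by
  have hexp : Tendsto (fun p : ℕ × ℕ =>
      Real.exp (-∫ z, (1 - ‖z‖) ∂(opucZeroMeasure (a · p.2) p.1))) (ratioAtTop t) (𝓝 1) := by
    refine tendsto_of_tendsto_of_tendsto_of_le_of_le' (ratioTendsto_iff.1 hroot)
      tendsto_const_nhds ?_ (Eventually.of_forall fun p => ?_)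
    · filter_upwards [(tendsto_fst_ratioAtTop t).eventually_ne_atTop 0] with p hp
      exact norm_rpow_le_exp_neg_integral_one_sub_norm (a · p.2) hp
    · refine Real.exp_le_one_iff.2 (neg_nonpos.2 (integral_nonneg_of_ae ?_))
      exact (ae_norm_le_one_opucZeroMeasure (ha · p.2) p.1).mono fun z hz => sub_nonneg.2 hz
  simpa using (hexp.log one_ne_zero).neg

theorem tendsto_integral_pow_opucZeroMeasure (ht : 0 < t) {α : ℝ → ℂ} (ha : ∀ n N, ‖a n N‖ ≤ 1)
    (hlim : ∀ᵐ s ∂(volume.restrict (Set.Icc 0 t)), RatioTendsto a s (α s)) {m : ℕ} (hm : m ≠ 0) :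
    Tendsto (fun p : ℕ × ℕ => ∫ z, z ^ m ∂(opucZeroMeasure (a · p.2) p.1)) (ratioAtTop t)
      (𝓝 (⨍ s in Set.Icc 0 t, PowerSeries.coeff m (negLogDeriv (limitRatio (α s))))) := by
  obtain ⟨B, hB⟩ := exists_bound_coeff_negLogDeriv_opucRatio m
  simp only [integral_opucZeroMeasure, sum_roots_opuc_pow _ _ hm]
  exact tendsto_average_of_ae_ratioTendsto
    (x := fun n N => PowerSeries.coeff m (negLogDeriv (opucRatio (a · N) n))) ht
    (fun n N => hB _ (ha · N) n)
    (hlim.mono fun s hs => ratioTendsto_iff.2 (hs.coeff_negLogDeriv_opucRatio m))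

end ZeroMeasure

section AveragedArcMeasure

theorem exists_isMarkovKernel_ae_eq_arcMeasure {S : Type*} [MeasurableSpace S] {μ : Measure S}
    {b : S → ℝ} (hb : AEMeasurable b μ) (hb01 : ∀ᵐ s ∂μ, b s ∈ Set.Icc 0 1) :
    ∃ κ : ProbabilityTheory.Kernel S ℂ, ProbabilityTheory.IsMarkovKernel κ ∧
      (∀ s, ∀ᵐ z ∂(κ s), ‖z‖ = 1) ∧ (fun s => arcMeasure (b s)) =ᵐ[μ] κ := by
  obtain ⟨g, hg, hg01, hbg⟩ := hb.exists_ae_eq_range_subset hb01 ⟨0, by simp⟩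
  have hmem (s : S) : g s ∈ Set.Icc 0 1 := hg01 (Set.mem_range_self s)
  exact ⟨⟨fun s => arcMeasure (g s), measurable_arcMeasure.comp hg⟩,
    ⟨fun s => isProbabilityMeasure_arcMeasure (hmem s).1 (hmem s).2⟩,
    fun s => ae_norm_eq_one_arcMeasure (hmem s).1 (hmem s).2,
    hbg.mono fun s hs => congrArg arcMeasure hs⟩

variable {α : ℝ → ℂ} {t : ℝ}

theorem exists_isMarkovKernel_averagedArcMeasure_eq
    (hα : AEMeasurable α (volume.restrict (Set.Icc 0 t)))
    (hα1 : ∀ᵐ s ∂(volume.restrict (Set.Icc 0 t)), ‖α s‖ ≤ 1) :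
    ∃ κ : ProbabilityTheory.Kernel ℝ ℂ, ProbabilityTheory.IsMarkovKernel κ ∧
      (∀ s, ∀ᵐ z ∂(κ s), ‖z‖ = 1) ∧
      (fun s => arcMeasure ‖α s‖) =ᵐ[volume.restrict (Set.Icc 0 t)] κ ∧
      averagedArcMeasure α t = (ProbabilityTheory.cond volume (Set.Icc 0 t)).bind κ := by
  obtain ⟨κ, hκ, hκ1, hακ⟩ := exists_isMarkovKernel_ae_eq_arcMeasure hα.norm
    (hα1.mono fun s hs => ⟨norm_nonneg (α s), hs⟩)
  refine ⟨κ, hκ, hκ1, hακ, ?_⟩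
  rw [averagedArcMeasure, Measure.bind_congr_right hακ, ProbabilityTheory.cond, Measure.comp_smul,
    Real.volume_Icc, sub_zero]

theorem isProbabilityMeasure_averagedArcMeasure (ht : 0 < t)
    (hα : AEMeasurable α (volume.restrict (Set.Icc 0 t)))
    (hα1 : ∀ᵐ s ∂(volume.restrict (Set.Icc 0 t)), ‖α s‖ ≤ 1) :
    IsProbabilityMeasure (averagedArcMeasure α t) := by
  obtain ⟨κ, _, -, -, hκ⟩ := exists_isMarkovKernel_averagedArcMeasure_eq hα hα1
  have : IsProbabilityMeasure (ProbabilityTheory.cond volume (Set.Icc 0 t)) :=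
    ProbabilityTheory.cond_isProbabilityMeasure_of_finite (by simpa) (by simp)
  rw [hκ]
  infer_instance

theorem ae_norm_eq_one_averagedArcMeasure
    (hα : AEMeasurable α (volume.restrict (Set.Icc 0 t)))
    (hα1 : ∀ᵐ s ∂(volume.restrict (Set.Icc 0 t)), ‖α s‖ ≤ 1) :
    ∀ᵐ z ∂(averagedArcMeasure α t), ‖z‖ = 1 := by
  obtain ⟨κ, _, hκ1, -, hκ⟩ := exists_isMarkovKernel_averagedArcMeasure_eq hα hα1
  rw [hκ]
  exact Measure.ae_comp_of_ae_ae (measurableSet_eq_fun measurable_norm measurable_const)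
    (Eventually.of_forall hκ1)

theorem integral_averagedArcMeasure {E : Type*} [NormedAddCommGroup E] [NormedSpace ℝ E]
    (ht : 0 < t) (hα : AEMeasurable α (volume.restrict (Set.Icc 0 t)))
    (hα1 : ∀ᵐ s ∂(volume.restrict (Set.Icc 0 t)), ‖α s‖ ≤ 1) {g : ℂ → E} (hg : Continuous g) :
    ∫ z, g z ∂(averagedArcMeasure α t) =
      ⨍ s in Set.Icc 0 t, ∫ z, g z ∂(arcMeasure ‖α s‖) := by
  have := isProbabilityMeasure_averagedArcMeasure ht hα hα1
  have hint : Integrable g (averagedArcMeasure α t) :=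
    integrable_of_ae_norm_le ((ae_norm_eq_one_averagedArcMeasure hα hα1).mono fun z hz => hz.le) hg
  obtain ⟨κ, _, -, hακ, hκ⟩ := exists_isMarkovKernel_averagedArcMeasure_eq hα hα1
  rw [hκ, Measure.comp_eq_comp_const_apply] at hint ⊢
  rw [ProbabilityTheory.Kernel.integral_comp hint, ProbabilityTheory.Kernel.const_apply,
    setAverage_eq']
  exact integral_congr_ae (Measure.ae_smul_measure
    (hακ.mono fun s hs => congrArg (fun μ => ∫ z, g z ∂μ) hs.symm) _)

theorem integral_pow_averagedArcMeasure (ht : 0 < t)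
    (hα : AEMeasurable α (volume.restrict (Set.Icc 0 t)))
    (hα1 : ∀ᵐ s ∂(volume.restrict (Set.Icc 0 t)), ‖α s‖ ≤ 1) {m : ℕ} (hm : m ≠ 0) :
    ∫ z, z ^ m ∂(averagedArcMeasure α t) =
      ⨍ s in Set.Icc 0 t, PowerSeries.coeff m (negLogDeriv (limitRatio (α s))) := by
  rw [integral_averagedArcMeasure ht hα hα1 (continuous_pow m), setAverage_eq, setAverage_eq]
  congr 1
  exact integral_congr_ae (hα1.mono fun s hs => integral_pow_arcMeasure_norm hs hm)

end AveragedArcMeasure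

section Main

variable {α : ℝ → ℂ} {t : ℝ} {a : ℕ → ℕ → ℂ}

theorem ae_tendsto_floor_mul_of_ae_ratioTendsto {X : Type*} [TopologicalSpace X] {x : ℕ → ℕ → X}
    {y : ℝ → X} (h : ∀ᵐ s ∂(volume.restrict (Set.Icc 0 t)), RatioTendsto x s (y s)) :
    ∀ᵐ s ∂(volume.restrict (Set.Icc 0 t)),
      Tendsto (fun j : ℕ => x ⌊(j : ℝ) * s⌋₊ j) atTop (𝓝 (y s)) := by
  filter_upwards [h, Measure.ae_ne _ 0, ae_restrict_mem measurableSet_Icc] with s hs hs0 hst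
  exact (ratioTendsto_iff.1 hs).comp (tendsto_floor_mul_id_ratioAtTop (hst.1.lt_of_ne' hs0))

theorem aemeasurable_of_ae_ratioTendsto {X : Type*} [TopologicalSpace X]
    [TopologicalSpace.PseudoMetrizableSpace X] [MeasurableSpace X] [BorelSpace X]
    {x : ℕ → ℕ → X} {y : ℝ → X}
    (h : ∀ᵐ s ∂(volume.restrict (Set.Icc 0 t)), RatioTendsto x s (y s)) :
    AEMeasurable y (volume.restrict (Set.Icc 0 t)) :=
  aemeasurable_of_tendsto_metrizable_ae atTop
    (fun j => ((measurable_from_nat (f := (x · j))).comp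
      (Nat.measurable_floor.comp (measurable_const_mul (j : ℝ)))).aemeasurable)
    (ae_tendsto_floor_mul_of_ae_ratioTendsto h)

theorem ae_norm_le_one_of_ae_ratioTendsto (ha : ∀ n N, ‖a n N‖ ≤ 1)
    (hlim : ∀ᵐ s ∂(volume.restrict (Set.Icc 0 t)), RatioTendsto a s (α s)) :
    ∀ᵐ s ∂(volume.restrict (Set.Icc 0 t)), ‖α s‖ ≤ 1 :=
  (ae_tendsto_floor_mul_of_ae_ratioTendsto hlim).mono fun _ hs =>
    le_of_tendsto hs.norm (Eventually.of_forall fun j => ha _ j)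

theorem theorem5p3_general (ht : 0 < t) (ha : ∀ n N, ‖a n N‖ ≤ 1)
    (hlim : ∀ᵐ s ∂(volume.restrict (Set.Icc 0 t)), RatioTendsto a s (α s))
    (hroot : RatioTendsto (fun n N => ‖a (n - 1) N‖ ^ (1 / (n : ℝ))) t 1) :
    RatioWeakTendsto (fun n N => opucZeroMeasure (fun k => a k N) n) t
      (averagedArcMeasure α t) := by
  have hα := aemeasurable_of_ae_ratioTendsto hlim
  have hα1 := ae_norm_le_one_of_ae_ratioTendsto ha hlim
  have := isProbabilityMeasure_averagedArcMeasure ht hα hα1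
  have hmoments (m : ℕ) :
      Tendsto (fun p : ℕ × ℕ => ∫ z, z ^ m ∂(opucZeroMeasure (a · p.2) p.1)) (ratioAtTop t)
        (𝓝 (∫ z, z ^ m ∂(averagedArcMeasure α t))) := by
    obtain rfl | hm := eq_or_ne m 0
    · refine tendsto_const_nhds.congr' ?_
      filter_upwards [(tendsto_fst_ratioAtTop t).eventually_ne_atTop 0] with p hp
      simp [Measure.real, opucZeroMeasure_univ _ hp]
    · rw [integral_pow_averagedArcMeasure ht hα hα1 hm]
      exact tendsto_integral_pow_opucZeroMeasure ht ha hlim hm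
  exact fun f => ratioTendsto_iff.2 (tendsto_integral_real_of_tendsto_moments
    (μ := fun p : ℕ × ℕ => opucZeroMeasure (a · p.2) p.1)
    (fun p => ae_norm_le_one_opucZeroMeasure (ha · p.2) p.1)
    (ae_norm_eq_one_averagedArcMeasure hα hα1)
    (tendsto_integral_one_sub_norm_opucZeroMeasure ha hroot) hmoments f.continuous)

end Main

theorem theorem5p3 (t : ℝ) (ht : 0 < t) (α : ℝ → ℂ)
    (hα_meas : NullMeasurable α (volume.restrict (Set.Icc 0 t)))
    (hα_disk : ∀ s ∈ Set.Icc 0 t, ‖α s‖ ≤ 1)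
    (a : ℕ → ℕ → ℂ) (ha : ∀ n N, ‖a n N‖ < 1)
    (hlim : ∀ᵐ s ∂(volume.restrict (Set.Icc 0 t)), RatioTendsto a s (α s))
    (hroot : RatioTendsto (fun n N => ‖a (n - 1) N‖ ^ (1 / (n : ℝ))) t 1) :
    RatioWeakTendsto (fun n N => opucZeroMeasure (fun k => a k N) n) t
      (averagedArcMeasure α t) :=
  theorem5p3_general ht (fun n N => (ha n N).le) hlim hroot
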